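/- Let $\mathcal H$ be a real separable infinite-dimensional Hilbert space, with $(f\otimes g)u=\langle g,u\rangle f$, and let $(X_i,y_i)$, $i\ge 1$, be i.i.d. with $y_i=a+\langle X_i,\beta\rangle+\epsilon_i$, where $a\in\mathbb R$, $\beta\in\mathcal H$, and $\epsilon_i$ is independent of $X_i$ with mean zero and finite variance. Assume: (A1) $X_1$ is a centered Gaussian random element of $\mathcal H$. (A2) The covariance operator $\mathscr K$ of $X_1$ has eigenvalues $\lambda_1>\lambda_2>\cdots>0$ with orthonormal eigenvectors $\phi_1,\phi_2,\dots$ forming a basis of $\mathcal H$, and for some constants $\alpha>1$, $0<c_1<c_2$, $j_0\ge 1$ one has $c_1j^{-\alpha}\le\lambda_j\le c_2j^{-\alpha}$ for all $j\ge j_0$. (A3) For some constants $d>0$, $\eta>1/2$, $j_0\ge1$ one has $|\langle\beta,\phi_j\rangle|\le dj^{-\eta}$ for all $j\ge j_0$. From the first $n$ pairs let $\bar X,\bar y$ be the sample means and $$\hat{\mathscr K}=\frac1n\sum_{i=1}^nX_i\otimes X_i=\sum_{j=1}^n\hat\lambda_j\,\hat\phi_j\otimes\hat\phi_j,\qquad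 \hat C=\frac1n\sum_{i=1}^n(y_i-\bar y)(X_i-\bar X),$$ with $\hat\lambda_1\ge\cdots\ge\hat\lambda_n\ge0$ and $\hat\phi_1,\dots,\hat\phi_n$ orthonormal, chosen as measurable functions of $X_1,\dots,X_n$. Fix $r\in\mathbb N$, let $\hat{\mathscr P}_1=\sum_{j=1}^{r}\hat\phi_j\otimes\hat\phi_j$ (for $n\ge r$), $\hat{\mathscr P}_2=\mathscr I-\hat{\mathscr P}_1$, $\hat Y_i=\hat{\mathscr P}_1X_i$, $\hat Z_i=\hat{\mathscr P}_2X_i$, and let $\hat{\mathscr K}_1=\frac1n\sum_i\hat Y_i\otimes\hat Y_i$, $\hat{\mathscr K}_2=\frac1n\sum_i\hat Z_i\otimes\hat Z_i$, $\hat C_1=\frac1n\sum_i(y_i-\bar y)(\hat Y_i-\frac1n\sum_k\hat Y_k)$, $\hat C_2=\frac1n\sum_i(y_i-\bar y)(\hat Z_i-\frac1n\sum_k\hat Z_k)$. For a regularisation parameter $\rho=\rho(n)$, the Tikhonov and the hybrid estimator are $$\hat\beta_{TR}=(\hat{\mathscr K}+\rho\mathscr I)^{-1}\hat C,\qquad \hat\beta_{HR}=\hat{\mathscr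 K}_1^{-}\hat C_1+(\hat{\mathscr K}_2+\rho\hat{\mathscr P}_2)^{-}\hat C_2,$$ where $^{-}$ denotes the Moore--Penrose generalised inverse, and $\mathrm{MSE}(\delta)=\mathbb E\|\delta-\beta\|^2$. Suppose that (A1)--(A3) hold with $\alpha<2\eta$, that $\rho\sim cn^{-\varepsilon}$ for some $c>0$ and $\varepsilon>0$, and that at least one of $\langle\beta,\phi_j\rangle$, $j=1,\dots,r$, is nonzero. Suppose further that either $\eta-\frac12<\alpha<2\eta$ and $\varepsilon<\alpha/(5\alpha-2\eta+2)$, or $\alpha<\eta-\frac12$ and $\varepsilon<\alpha/(3\alpha+1)$. Then there is a constant $\kappa_0>0$ such that, for all sufficiently large $n$, both mean squared errors are finite and $$\mathrm{MSE}(\hat\beta_{TR})-\mathrm{MSE}(\hat\beta_{HR})>\kappa_0\,n^{-2\varepsilon}.$$ -/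

import Mathlib

open MeasureTheory ProbabilityTheory Filter Asymptotics
open scoped Topology

namespace HybridReg

noncomputable section

section Operators

variable {H : Type*} [NormedAddCommGroup H] [InnerProductSpace ℝ H] [CompleteSpace H]

/-- The four Penrose equations: `B` is the Moore-Penrose generalised inverse of the bounded
operator `A`. -/
structure IsMoorePenroseInverse (A B : H →L[ℝ] H) : Prop where
  mul_mul_left : A * B * A = A
  mul_mul_right : B * A * B = B
  selfAdjoint_left : IsSelfAdjoint (A * B)
  selfAdjoint_right : IsSelfAdjoint (B * A)

theorem IsMoorePenroseInverse.unique {A B C : H →L[ℝ] H}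
    (hB : IsMoorePenroseInverse A B) (hC : IsMoorePenroseInverse A C) : B = C := by
  have h1 : A * B = A * C := by
    calc A * B = star (A * B) := hB.selfAdjoint_left.star_eq.symm
      _ = star ((A * C) * (A * B)) := by
          congr 1
          rw [← mul_assoc, hC.mul_mul_left]
      _ = star (A * B) * star (A * C) := star_mul _ _
      _ = (A * B) * (A * C) := by
          rw [hB.selfAdjoint_left.star_eq, hC.selfAdjoint_left.star_eq]
      _ = A * C := by rw [← mul_assoc, hB.mul_mul_left]
  have h2 : B * A = C * A := by
    calc B * A = star (B * A) := hB.selfAdjoint_right.star_eq.symm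
      _ = star ((B * A) * (C * A)) := by
          congr 1
          rw [mul_assoc, ← mul_assoc A C A, hC.mul_mul_left]
      _ = star (C * A) * star (B * A) := star_mul _ _
      _ = (C * A) * (B * A) := by
          rw [hB.selfAdjoint_right.star_eq, hC.selfAdjoint_right.star_eq]
      _ = C * A := by rw [mul_assoc, ← mul_assoc A B A, hB.mul_mul_left]
  calc B = B * A * B := hB.mul_mul_right.symm
    _ = B * (A * C) := by rw [mul_assoc, h1]
    _ = C * A * C := by rw [← mul_assoc, h2]
    _ = C := hC.mul_mul_right

open Classical in
/-- The Moore-Penrose generalised inverse of a bounded operator. It is a bounded operator exactly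
when the range is closed, which is the case for all the operators below when `0 < ρ`; the value
is `0` when no bounded Moore-Penrose inverse exists. -/
def pinv (A : H →L[ℝ] H) : H →L[ℝ] H :=
  if h : ∃ B, IsMoorePenroseInverse A B then h.choose else 0

theorem pinv_eq {A B : H →L[ℝ] H} (h : IsMoorePenroseInverse A B) : pinv A = B := by
  have hex : ∃ B, IsMoorePenroseInverse A B := ⟨B, h⟩
  rw [pinv, dif_pos hex]
  exact hex.choose_spec.unique h

end Operators

section Estimators

variable {H : Type*} [NormedAddCommGroup H] [InnerProductSpace ℝ H] {n : ℕ}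

/-- The sample mean. -/
def sampleMean {E : Type*} [AddCommMonoid E] [Module ℝ E] (x : Fin n → E) : E :=
  (n : ℝ)⁻¹ • ∑ i, x i

/-- The empirical covariance operator `n⁻¹ ∑ᵢ xᵢ ⊗ xᵢ` of a sample of a centred variable,
where `(f ⊗ g) u = ⟪g, u⟫ f`. -/
def empCov (x : Fin n → H) : H →L[ℝ] H :=
  (n : ℝ)⁻¹ • ∑ i, InnerProductSpace.rankOne ℝ (x i) (x i)

/-- The empirical cross-covariance `n⁻¹ ∑ᵢ (yᵢ - ȳ) (xᵢ - x̄)`. -/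
def empCrossCov (x : Fin n → H) (y : Fin n → ℝ) : H :=
  (n : ℝ)⁻¹ • ∑ i, (y i - sampleMean y) • (x i - sampleMean x)

/-- `K = ∑_{j ≤ n} lam_j φ_j ⊗ φ_j` with `φ` orthonormal and `lam_1 ≥ ... ≥ lam_n ≥ 0`. -/
structure IsSpectrum (K : H →L[ℝ] H) (lam : Fin n → ℝ) (φ : Fin n → H) : Prop where
  orthonormal : Orthonormal ℝ φ
  antitone : Antitone lam
  nonneg : ∀ j, 0 ≤ lam j
  eq_sum : K = ∑ j, lam j • InnerProductSpace.rankOne ℝ (φ j) (φ j)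

/-- The projection `∑_{j ≤ r} φ_j ⊗ φ_j` onto the span of the first `r` of the vectors
`φ_1, ..., φ_n` (which are indexed from `0` here). -/
def leadProj (r : ℕ) (φ : Fin n → H) : H →L[ℝ] H :=
  ∑ j ∈ Finset.univ.filter (fun j : Fin n => j.val < r), InnerProductSpace.rankOne ℝ (φ j) (φ j)

/-- The Tikhonov estimator `(K̂ + ρ I)⁻¹ Ĉ`. -/
def tikhonov (ρ : ℝ) (x : Fin n → H) (y : Fin n → ℝ) : H :=
  ContinuousLinearMap.inverse (empCov x + ρ • ContinuousLinearMap.id ℝ H) (empCrossCov x y)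

/-- The hybrid estimator `K̂₁⁻ Ĉ₁ + (K̂₂ + ρ P̂₂)⁻ Ĉ₂`, where `P̂₁` is the projection onto the span of
the first `r` of the empirical eigenvectors `φ`, `P̂₂ = I - P̂₁`, and `K̂ₖ`, `Ĉₖ` are the empirical
covariance operator of the `P̂ₖ xᵢ` and their empirical cross-covariance with the `yᵢ`. -/
def hybrid [CompleteSpace H] (r : ℕ) (ρ : ℝ) (φ : Fin n → H) (x : Fin n → H) (y : Fin n → ℝ) : H :=
  let P₁ : H →L[ℝ] H := leadProj r φ
  let P₂ : H →L[ℝ] H := ContinuousLinearMap.id ℝ H - P₁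
  let Y : Fin n → H := fun i => P₁ (x i)
  let Z : Fin n → H := fun i => P₂ (x i)
  pinv (empCov Y) (empCrossCov Y y) + pinv (empCov Z + ρ • P₂) (empCrossCov Z y)

/-- The squared error loss of the random estimate `δ` of `β`. -/
def sqLoss {Ω : Type*} (δ : Ω → H) (β : H) (ω : Ω) : ℝ := ‖δ ω - β‖ ^ 2

/-- The mean squared error `E ‖δ - β‖²`. -/
def MSE {Ω : Type*} [MeasurableSpace Ω] (P : Measure Ω) (δ : Ω → H) (β : H) : ℝ :=
  ∫ ω, sqLoss δ β ω ∂P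

end Estimators

/-- Eigenvalue condition: `lam` is positive, strictly decreasing and of exact order `j ^ (-α)`
with `α > 1`. Indexing starts at `0`: the usual `j`-th eigenvalue, `j ≥ 1`, is
`lam (j - 1)`. -/
def EigenvalueDecay (α : ℝ) (lam : ℕ → ℝ) : Prop :=
  1 < α ∧ (∀ j, 0 < lam j) ∧ StrictAnti lam ∧
    ∃ c C : ℝ, ∃ j₀ : ℕ, 0 < c ∧ c < C ∧ ∀ j ≥ j₀,
      c * ((j : ℝ) + 1) ^ (-α) ≤ lam j ∧ lam j ≤ C * ((j : ℝ) + 1) ^ (-α)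

/-- Coefficient condition: `|b j| ≤ d j ^ (-η)` for all large `j`, with `η > 1 / 2` (same
indexing). -/
def CoefficientDecay (η : ℝ) (b : ℕ → ℝ) : Prop :=
  1 / 2 < η ∧ ∃ d : ℝ, ∃ j₀ : ℕ, 0 < d ∧ ∀ j ≥ j₀, |b j| ≤ d * ((j : ℝ) + 1) ^ (-η)

end

end HybridReg

/-! Both estimators are diagonal in the empirical eigenbasis. Tikhonov multiplies the coefficient of
the cross-covariance along the `j`-th eigenvector by `(λ̂_j + ρ)⁻¹`; the hybrid uses `λ̂_j⁻¹` for
the first `r` indices and agrees with Tikhonov elsewhere. Hence only `r` terms survive in the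
difference of the losses (`norm_tikhonov_sub_sq_sub_norm_hybrid_sub_sq`). With `b = ⟪φ̂_j, β⟫` and
`ν` the error of the unpenalised coefficient, each term is at least `½ (ρ / (λ̂_j + ρ))² b² - 3 ν²`
(`shrinkage_gain`): a squared shrinkage bias against a variance.

The bias is of order `ρ²`. By the law of large numbers the empirical covariance is close to the true
one with probability at least one half. On that event a nonzero coefficient of `β` along some `φ_k`,
`k < r`, is still seen by the span of the first `r` empirical eigenvectors, because `λ_k > λ_r`
(`IsSpectrum.sum_inner_sq_ge`). No convergence of individual eigenvectors is needed.

The variance is `O(n⁻¹)` (`exists_lintegral_coefficientError_le`). This is the delicate part, since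
it needs `E λ̂_j⁻²` bounded in `n`. By Courant-Fischer, `λ̂_j` dominates the value of the empirical
form at some unit vector of a fixed finite-dimensional `V`. The sample is cut into blocks of fixed
length. On each block the worst inverse value over the unit sphere of `V` is dominated by an
integral over an annulus (`inverseBound`), whose expectation is finite by Gaussian small-ball
bounds, and Jensen averages the blocks.

Both regimes force `ε < 1/2`, so `n⁻¹` is negligible against `ρ² ≍ n^(-2ε)`. -/

namespace HybridReg

noncomputable section

/-! ### Operators diagonal along a finite orthonormal family. -/

section DiagOp

variable {H : Type*} [NormedAddCommGroup H] [InnerProductSpace ℝ H] {n : ℕ}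

/-- The operator with eigenvalues `f j` on `φ j` and `g` on the orthogonal complement of `φ`. -/
def diagOp (φ : Fin n → H) (f : Fin n → ℝ) (g : ℝ) : H →L[ℝ] H :=
  g • ContinuousLinearMap.id ℝ H + ∑ j, (f j - g) • InnerProductSpace.rankOne ℝ (φ j) (φ j)

theorem diagOp_apply (φ : Fin n → H) (f : Fin n → ℝ) (g : ℝ) (z : H) :
    diagOp φ f g z = g • z + ∑ j, ((f j - g) * inner ℝ (φ j) z) • φ j := by
  simp [diagOp, smul_smul]

theorem inner_diagOp {φ : Fin n → H} (hφ : Orthonormal ℝ φ) (f : Fin n → ℝ) (g : ℝ) (j : Fin n)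
    (z : H) : inner ℝ (φ j) (diagOp φ f g z) = f j * inner ℝ (φ j) z := by
  rw [diagOp_apply, inner_add_right, inner_smul_right, hφ.inner_right_fintype]
  ring

theorem diagOp_mul {φ : Fin n → H} (hφ : Orthonormal ℝ φ) (f f' : Fin n → ℝ) (g g' : ℝ) :
    diagOp φ f g * diagOp φ f' g' = diagOp φ (f * f') (g * g') := by
  ext z
  rw [mul_apply_eq_comp, diagOp_apply φ f g]
  simp_rw [inner_diagOp hφ]
  rw [diagOp_apply, diagOp_apply, smul_add, Finset.smul_sum, add_assoc, ← Finset.sum_add_distrib,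
    smul_smul]
  congr 1
  refine Finset.sum_congr rfl fun j _ => ?_
  rw [smul_smul, ← add_smul, Pi.mul_apply]
  congr 1
  ring

theorem diagOp_add (φ : Fin n → H) (f f' : Fin n → ℝ) (g g' : ℝ) :
    diagOp φ f g + diagOp φ f' g' = diagOp φ (f + f') (g + g') := by
  ext z
  simp only [_root_.add_apply, diagOp_apply, add_smul, Pi.add_apply]
  rw [add_add_add_comm, ← Finset.sum_add_distrib]
  congr 1
  refine Finset.sum_congr rfl fun j _ => ?_
  rw [← add_smul]
  congr 1
  ring

theorem smul_diagOp (φ : Fin n → H) (f : Fin n → ℝ) (g c : ℝ) :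
    c • diagOp φ f g = diagOp φ (c • f) (c * g) := by
  ext z
  simp only [_root_.smul_apply, diagOp_apply, smul_add, Finset.smul_sum, smul_smul,
    Pi.smul_apply, smul_eq_mul]
  congr 1
  refine Finset.sum_congr rfl fun j _ => ?_
  congr 1
  ring

theorem id_eq_diagOp (φ : Fin n → H) : ContinuousLinearMap.id ℝ H = diagOp φ 1 1 := by
  ext z
  simp [diagOp_apply]

theorem IsSpectrum.eq_diagOp {K : H →L[ℝ] H} {lam : Fin n → ℝ} {φ : Fin n → H}
    (h : IsSpectrum K lam φ) : K = diagOp φ lam 0 := by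
  rw [h.eq_sum]
  simp [diagOp]

theorem leadProj_eq_diagOp (r : ℕ) (φ : Fin n → H) :
    leadProj r φ = diagOp φ (fun j => if j.val < r then 1 else 0) 0 := by
  simp [leadProj, diagOp, Finset.sum_filter, ite_smul]

theorem inner_diagOp_comm (φ : Fin n → H) (f : Fin n → ℝ) (g : ℝ) (z w : H) :
    inner ℝ (diagOp φ f g z) w = inner ℝ z (diagOp φ f g w) := by
  simp only [diagOp_apply, inner_add_left, inner_add_right, sum_inner, inner_sum,
    real_inner_smul_left, real_inner_smul_right]
  congr 1
  refine Finset.sum_congr rfl fun j _ => ?_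
  rw [real_inner_comm (φ j) z]
  ring

/-- Pythagoras for the span of `φ` and its complement. The complementary part depends on `g` but not
on `f`, so it cancels between two estimators that share `g`. -/
theorem norm_sq_diagOp_sub {φ : Fin n → H} (hφ : Orthonormal ℝ φ) (f : Fin n → ℝ) (g : ℝ)
    (C β : H) : ‖diagOp φ f g C - β‖ ^ 2 =
      ‖diagOp φ 0 g C - diagOp φ 0 1 β‖ ^ 2
        + ∑ j, (f j * inner ℝ (φ j) C - inner ℝ (φ j) β) ^ 2 := by
  have h1 : diagOp φ f g C - β = (diagOp φ 0 g C - diagOp φ 0 1 β) +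
      ∑ j, (f j * inner ℝ (φ j) C - inner ℝ (φ j) β) • φ j := by
    simp only [diagOp_apply, Pi.zero_apply, one_smul, sub_smul, sub_mul, Finset.sum_sub_distrib,
      zero_mul, zero_smul, Finset.sum_const_zero, one_mul]
    abel
  have h2 : ∀ j, inner ℝ (φ j) (diagOp φ 0 g C - diagOp φ 0 1 β) = 0 := by
    intro j
    rw [inner_sub_right, inner_diagOp hφ, inner_diagOp hφ]
    simp
  rw [h1, ← real_inner_self_eq_norm_sq, ← real_inner_self_eq_norm_sq, inner_add_left,
    inner_add_right, inner_add_right, hφ.inner_sum]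
  have h3 : inner ℝ (∑ j, (f j * inner ℝ (φ j) C - inner ℝ (φ j) β) • φ j)
      (diagOp φ 0 g C - diagOp φ 0 1 β) = 0 := by
    rw [sum_inner]
    refine Finset.sum_eq_zero fun j _ => ?_
    rw [real_inner_smul_left, h2, mul_zero]
  have h4 := real_inner_comm (∑ j, (f j * inner ℝ (φ j) C - inner ℝ (φ j) β) • φ j)
    (diagOp φ 0 g C - diagOp φ 0 1 β)
  rw [h4, h3]
  simp [pow_two]

theorem inverse_diagOp {φ : Fin n → H} (hφ : Orthonormal ℝ φ) {f : Fin n → ℝ} {g : ℝ}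
    (hf : ∀ j, f j ≠ 0) (hg : g ≠ 0) :
    ContinuousLinearMap.inverse (diagOp φ f g) = diagOp φ f⁻¹ g⁻¹ := by
  have hf' : f * f⁻¹ = 1 := by
    funext j
    simp [hf j]
  refine ContinuousLinearMap.inverse_eq ?_ ?_
  · change diagOp φ f g * diagOp φ f⁻¹ g⁻¹ = _
    rw [diagOp_mul hφ, hf', mul_inv_cancel₀ hg, ← id_eq_diagOp]
  · change diagOp φ f⁻¹ g⁻¹ * diagOp φ f g = _
    rw [diagOp_mul hφ, mul_comm f⁻¹, hf', inv_mul_cancel₀ hg, ← id_eq_diagOp]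

variable [CompleteSpace H]

theorem isSelfAdjoint_diagOp (φ : Fin n → H) (f : Fin n → ℝ) (g : ℝ) :
    IsSelfAdjoint (diagOp φ f g) := by
  rw [ContinuousLinearMap.isSelfAdjoint_iff_isSymmetric]
  intro z w
  exact inner_diagOp_comm φ f g z w

/-- Entrywise inversion with the convention `0⁻¹ = 0` satisfies the four Penrose equations, so no
case distinction on vanishing eigenvalues is needed. -/
theorem pinv_diagOp {φ : Fin n → H} (hφ : Orthonormal ℝ φ) (f : Fin n → ℝ) (g : ℝ) :
    pinv (diagOp φ f g) = diagOp φ f⁻¹ g⁻¹ := by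
  refine pinv_eq ⟨?_, ?_, ?_, ?_⟩
  · rw [diagOp_mul hφ, diagOp_mul hφ, mul_inv_mul_cancel]
    congr 1
    funext j
    simp
  · rw [diagOp_mul hφ, diagOp_mul hφ]
    have h (a : ℝ) : a⁻¹ * a * a⁻¹ = a⁻¹ := by
      simpa using mul_inv_mul_cancel a⁻¹
    congr 1
    · funext j
      exact h (f j)
    · exact h g
  · rw [diagOp_mul hφ]
    exact isSelfAdjoint_diagOp _ _ _
  · rw [diagOp_mul hφ]
    exact isSelfAdjoint_diagOp _ _ _

end DiagOp

/-! ### Diagonal form of the two estimators and the loss difference. -/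

section Formulas

variable {H : Type*} [NormedAddCommGroup H] [InnerProductSpace ℝ H] {n : ℕ}

theorem empCov_apply (x : Fin n → H) (z : H) :
    empCov x z = (n : ℝ)⁻¹ • ∑ i, (inner ℝ (x i) z : ℝ) • x i := by
  simp [empCov]

theorem inner_empCov (x : Fin n → H) (z : H) :
    inner ℝ z (empCov x z) = (n : ℝ)⁻¹ * ∑ i, (inner ℝ (x i) z : ℝ) ^ 2 := by
  rw [empCov_apply, inner_smul_right, inner_sum]
  congr 1
  refine Finset.sum_congr rfl fun i _ => ?_
  rw [inner_smul_right, real_inner_comm, pow_two]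

theorem empCov_comp_diagOp (φ : Fin n → H) (f : Fin n → ℝ) (g : ℝ) (x : Fin n → H) :
    empCov (fun i => diagOp φ f g (x i)) = diagOp φ f g * empCov x * diagOp φ f g := by
  ext z
  simp only [mul_apply_eq_comp, empCov_apply, map_smul, map_sum, inner_diagOp_comm]

theorem map_empCrossCov (L : H →L[ℝ] H) (x : Fin n → H) (y : Fin n → ℝ) :
    empCrossCov (fun i => L (x i)) y = L (empCrossCov x y) := by
  simp only [empCrossCov, sampleMean, map_smul, map_sum, map_sub]

theorem tikhonov_eq {x : Fin n → H} {lam : Fin n → ℝ} {φ : Fin n → H}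
    (h : IsSpectrum (empCov x) lam φ) {ρ : ℝ} (hρ : 0 < ρ) (y : Fin n → ℝ) :
    tikhonov ρ x y = diagOp φ (fun j => (lam j + ρ)⁻¹) ρ⁻¹ (empCrossCov x y) := by
  rw [tikhonov, h.eq_diagOp, id_eq_diagOp φ, smul_diagOp, diagOp_add, inverse_diagOp h.orthonormal]
  · congr 2
    · funext j
      simp
    · simp
  · intro j
    have := h.nonneg j
    simp only [Pi.add_apply, Pi.smul_apply, Pi.one_apply, smul_eq_mul, mul_one]
    positivity
  · simpa using hρ.ne'

/-- The leading projection is diagonal in the same basis as the empirical covariance. The two blocks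
have complementary supports, and each generalised inverse vanishes on the support of the other
because `0⁻¹ = 0`. -/
theorem hybrid_eq [CompleteSpace H] {x : Fin n → H} {lam : Fin n → ℝ} {φ : Fin n → H}
    (h : IsSpectrum (empCov x) lam φ) (ρ : ℝ) (r : ℕ) (y : Fin n → ℝ) :
    hybrid r ρ φ x y =
      diagOp φ (fun j => if j.val < r then (lam j)⁻¹ else (lam j + ρ)⁻¹) ρ⁻¹
        (empCrossCov x y) := by
  have hP2 : ContinuousLinearMap.id ℝ H - leadProj r φ =
      diagOp φ (fun j => if j.val < r then 0 else 1) 1 := by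
    rw [sub_eq_iff_eq_add, leadProj_eq_diagOp, diagOp_add, id_eq_diagOp φ]
    congr 1
    · funext j
      by_cases hj : j.val < r <;> simp [hj]
    · simp
  simp only [hybrid, hP2]
  simp only [leadProj_eq_diagOp]
  rw [empCov_comp_diagOp, empCov_comp_diagOp, map_empCrossCov, map_empCrossCov, h.eq_diagOp,
    diagOp_mul h.orthonormal, diagOp_mul h.orthonormal, diagOp_mul h.orthonormal,
    diagOp_mul h.orthonormal, smul_diagOp, diagOp_add, pinv_diagOp h.orthonormal,
    pinv_diagOp h.orthonormal, ← mul_apply_eq_comp, ← mul_apply_eq_comp,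
    diagOp_mul h.orthonormal, diagOp_mul h.orthonormal, ← _root_.add_apply, diagOp_add]
  congr 2
  · funext j
    by_cases hj : j.val < r <;> simp [hj]
  · simp

/-- Only the first `r` empirical components contribute to the difference of the losses. -/
theorem norm_tikhonov_sub_sq_sub_norm_hybrid_sub_sq [CompleteSpace H] {x : Fin n → H}
    {lam : Fin n → ℝ} {φ : Fin n → H} (h : IsSpectrum (empCov x) lam φ) {ρ : ℝ} (hρ : 0 < ρ)
    (r : ℕ) (y : Fin n → ℝ) (β : H) :
    ‖tikhonov ρ x y - β‖ ^ 2 - ‖hybrid r ρ φ x y - β‖ ^ 2 =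
      ∑ j : Fin n with j.val < r,
        (((lam j + ρ)⁻¹ * inner ℝ (φ j) (empCrossCov x y) - inner ℝ (φ j) β) ^ 2 -
          ((lam j)⁻¹ * inner ℝ (φ j) (empCrossCov x y) - inner ℝ (φ j) β) ^ 2) := by
  rw [tikhonov_eq h hρ, hybrid_eq h, norm_sq_diagOp_sub h.orthonormal _ _ _ β,
    norm_sq_diagOp_sub h.orthonormal (fun j => if j.val < r then _ else _) _ _ β, add_sub_add_left_eq_sub, ← Finset.sum_sub_distrib,
    Finset.sum_filter]
  refine Finset.sum_congr rfl fun j _ => ?_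
  by_cases hj : j.val < r <;> simp [hj]

/-- With `s = l / (l + ρ)` the penalised error is `s ν - (1 - s) b`. Then `(p - q)² ≥ p² / 2 - q²`
and `0 ≤ s ≤ 1` separate the bias from the variance. -/
theorem shrinkage_gain {l ρ : ℝ} (hl : 0 < l) (hρ : 0 < ρ) (c b : ℝ) :
    1 / 2 * (ρ / (l + ρ)) ^ 2 * b ^ 2 - 3 * (l⁻¹ * c - b) ^ 2 ≤
      ((l + ρ)⁻¹ * c - b) ^ 2 - (l⁻¹ * c - b) ^ 2 := by
  have hlρ : 0 < l + ρ := by positivity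
  set s := l / (l + ρ) with hs
  set ν := l⁻¹ * c - b with hν
  have h0 : 0 ≤ s := by positivity
  have h1 : s ≤ 1 := by rw [hs, div_le_one hlρ]; linarith
  have h2 : ρ / (l + ρ) = 1 - s := by rw [hs]; field_simp; ring
  have h3 : (l + ρ)⁻¹ * c = s * (ν + b) := by rw [hs, hν]; field_simp; ring
  rw [h2, h3]
  nlinarith [sq_nonneg ((1 - s) * b - 2 * s * ν), mul_nonneg h0 (sq_nonneg ν),
    mul_nonneg (sub_nonneg.2 h1) (sq_nonneg ν), mul_nonneg (mul_nonneg h0 (sub_nonneg.2 h1)) (sq_nonneg ν)]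

/-- A crude domination, used for the integrability of the loss difference. -/
theorem abs_shrinkage_gain_le {l ρ : ℝ} (hl : 0 < l) (hρ : 0 < ρ) (c b : ℝ) :
    |((l + ρ)⁻¹ * c - b) ^ 2 - (l⁻¹ * c - b) ^ 2| ≤ 2 * b ^ 2 + 3 * (l⁻¹ * c - b) ^ 2 := by
  have hlρ : 0 < l + ρ := by positivity
  set s := l / (l + ρ) with hs
  set ν := l⁻¹ * c - b with hν
  have h0 : 0 ≤ s := by positivity
  have h1 : s ≤ 1 := by rw [hs, div_le_one hlρ]; linarith
  have h3 : (l + ρ)⁻¹ * c = s * (ν + b) := by rw [hs, hν]; field_simp; ring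
  rw [h3]
  have e : s * (ν + b) - b = s * ν - (1 - s) * b := by ring
  rw [e]
  have h4 : s ^ 2 ≤ 1 := by nlinarith
  have h5 : (1 - s) ^ 2 ≤ 1 := by nlinarith
  have h6 : s ^ 2 * ν ^ 2 ≤ ν ^ 2 := by nlinarith [sq_nonneg ν]
  have h7 : (1 - s) ^ 2 * b ^ 2 ≤ b ^ 2 := by nlinarith [sq_nonneg b]
  rw [abs_le]
  constructor
  · nlinarith [sq_nonneg (s * ν - (1 - s) * b), sq_nonneg b]
  · nlinarith [sq_nonneg (s * ν + (1 - s) * b), sq_nonneg ν]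

theorem IsSpectrum.inner_eq {K : H →L[ℝ] H} {lam : Fin n → ℝ} {φ : Fin n → H}
    (h : IsSpectrum K lam φ) (j : Fin n) (z : H) :
    inner ℝ (φ j) (K z) = lam j * inner ℝ (φ j) z := by
  rw [h.eq_diagOp, inner_diagOp h.orthonormal]

theorem IsSpectrum.inner_apply_eq_sum {K : H →L[ℝ] H} {lam : Fin n → ℝ} {φ : Fin n → H}
    (h : IsSpectrum K lam φ) (z w : H) :
    inner ℝ w (K z) = ∑ j, lam j * (inner ℝ (φ j) z * inner ℝ (φ j) w) := by
  rw [h.eq_diagOp, diagOp_apply, inner_add_right, inner_sum]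
  simp only [zero_smul, inner_zero_right, zero_add, sub_zero, inner_smul_right]
  refine Finset.sum_congr rfl fun j _ => ?_
  rw [real_inner_comm (φ j) w]
  ring

theorem IsSpectrum.sum_inner_sq {x : Fin n → H} {lam : Fin n → ℝ} {φ : Fin n → H}
    (h : IsSpectrum (empCov x) lam φ) (j : Fin n) :
    (n : ℝ)⁻¹ * ∑ i, (inner ℝ (x i) (φ j) : ℝ) ^ 2 = lam j := by
  rw [← inner_empCov, h.inner_eq, real_inner_self_eq_norm_sq, h.orthonormal.1 j]
  simp

end Formulas

end

end HybridReg

namespace HybridReg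

noncomputable section

/-! ### Min-max and perturbation bounds for the empirical spectrum. -/

section Perturbation

variable {H : Type*} [NormedAddCommGroup H] [InnerProductSpace ℝ H] {n : ℕ}

theorem exists_ne_zero_mem_orthogonal (V : Submodule ℝ H) [FiniteDimensional ℝ V] {k : ℕ}
    (ψ : Fin k → H) (hk : k < Module.finrank ℝ V) :
    ∃ v ∈ V, v ≠ 0 ∧ ∀ i, inner ℝ (ψ i) v = 0 := by
  let L : V →ₗ[ℝ] (Fin k → ℝ) :=
    LinearMap.pi fun i => (innerₛₗ ℝ (ψ i)).comp V.subtype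
  have hL : LinearMap.ker L ≠ ⊥ := LinearMap.ker_ne_bot_of_finrank_lt (by simpa using hk)
  obtain ⟨v, hv, hv0⟩ := (Submodule.ne_bot_iff _).1 hL
  refine ⟨v, v.2, by simpa using hv0, fun i => ?_⟩
  have := congrFun (LinearMap.mem_ker.1 hv) i
  simpa [L] using this

theorem exists_norm_eq_one_mem_orthogonal (V : Submodule ℝ H) [FiniteDimensional ℝ V] {k : ℕ}
    (ψ : Fin k → H) (hk : k < Module.finrank ℝ V) :
    ∃ v ∈ V, ‖v‖ = 1 ∧ ∀ i, inner ℝ (ψ i) v = 0 := by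
  obtain ⟨v, hv, hv0, hψ⟩ := exists_ne_zero_mem_orthogonal V ψ hk
  refine ⟨‖v‖⁻¹ • v, V.smul_mem _ hv, norm_smul_inv_norm hv0, fun i => ?_⟩
  rw [inner_smul_right, hψ, mul_zero]

theorem sum_inner_sq_le {φ : Fin n → H} (hφ : Orthonormal ℝ φ) (s : Finset (Fin n)) (v : H) :
    ∑ j ∈ s, (inner ℝ (φ j) v : ℝ) ^ 2 ≤ ‖v‖ ^ 2 := by
  simpa using hφ.sum_inner_products_le v (s := s)

/-- One half of the Courant-Fischer principle. -/
theorem IsSpectrum.exists_inner_le {K : H →L[ℝ] H} {lam : Fin n → ℝ} {φ : Fin n → H}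
    (h : IsSpectrum K lam φ) (V : Submodule ℝ H) [FiniteDimensional ℝ V] (j : Fin n)
    (hj : j.val < Module.finrank ℝ V) :
    ∃ v ∈ V, ‖v‖ = 1 ∧ inner ℝ v (K v) ≤ lam j := by
  -- The dimension of `V` exceeds `j`, so some unit vector of `V` is orthogonal to the first `j`
  -- eigenvectors and only sees eigenvalues at most `lam j`.
  obtain ⟨v, hv, hv1, hψ⟩ := exists_norm_eq_one_mem_orthogonal V
    (fun i : Fin j.val => φ (i.castLE j.2.le)) hj
  refine ⟨v, hv, hv1, ?_⟩
  rw [h.inner_apply_eq_sum]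
  calc ∑ i, lam i * (inner ℝ (φ i) v * inner ℝ (φ i) v)
      ≤ ∑ i, lam j * (inner ℝ (φ i) v : ℝ) ^ 2 := by
        refine Finset.sum_le_sum fun i _ => ?_
        rw [← pow_two]
        by_cases hij : i.val < j.val
        · have : inner ℝ (φ i) v = 0 := hψ ⟨i.val, hij⟩
          simp [this]
        · exact mul_le_mul_of_nonneg_right (h.antitone (not_lt.1 hij)) (sq_nonneg _)
    _ = lam j * ∑ i, (inner ℝ (φ i) v : ℝ) ^ 2 := by rw [Finset.mul_sum]
    _ ≤ lam j * 1 := by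
        refine mul_le_mul_of_nonneg_left ?_ (h.nonneg j)
        simpa [hv1] using sum_inner_sq_le h.orthonormal Finset.univ v
    _ = lam j := mul_one _

theorem inner_apply_le_of_eigen {K : H →L[ℝ] H} (φ : HilbertBasis ℕ ℝ H) {lam : ℕ → ℝ}
    (hK : ∀ v k, inner ℝ (φ k) (K v) = lam k * inner ℝ (φ k) v) (hlam : Antitone lam)
    (k : ℕ) {v : H} (hv : ∀ i < k, inner ℝ (φ i) v = 0) :
    inner ℝ v (K v) ≤ lam k * ‖v‖ ^ 2 := by
  have h1 := φ.hasSum_inner_mul_inner v (K v)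
  have h2 := (φ.hasSum_inner_mul_inner v v).mul_left (lam k)
  rw [real_inner_self_eq_norm_sq] at h2
  refine hasSum_le (fun i => ?_) h1 h2
  rw [hK, real_inner_comm (φ i) v]
  by_cases hi : i < k
  · simp [hv i hi]
  · have := hlam (not_lt.1 hi)
    nlinarith [mul_le_mul_of_nonneg_right this (mul_self_nonneg (inner ℝ (φ i) v))]

theorem inner_apply_ge_of_eigen {K : H →L[ℝ] H} (φ : HilbertBasis ℕ ℝ H) {lam : ℕ → ℝ}
    (hK : ∀ v k, inner ℝ (φ k) (K v) = lam k * inner ℝ (φ k) v) (hlam : Antitone lam)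
    (k : ℕ) {v : H} (hv : ∀ i > k, inner ℝ (φ i) v = 0) :
    lam k * ‖v‖ ^ 2 ≤ inner ℝ v (K v) := by
  have h1 := φ.hasSum_inner_mul_inner v (K v)
  have h2 := (φ.hasSum_inner_mul_inner v v).mul_left (lam k)
  rw [real_inner_self_eq_norm_sq] at h2
  refine hasSum_le (fun i => ?_) h2 h1
  rw [hK, real_inner_comm (φ i) v]
  by_cases hi : k < i
  · simp [hv i hi]
  · have := hlam (not_lt.1 hi)
    nlinarith [mul_le_mul_of_nonneg_right this (mul_self_nonneg (inner ℝ (φ i) v))]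

theorem inner_apply_sub_le (K L : H →L[ℝ] H) (v w : H) :
    inner ℝ w (K v) - inner ℝ w (L v) ≤ ‖K - L‖ * ‖v‖ * ‖w‖ := by
  rw [← inner_sub_right, ← _root_.sub_apply]
  calc inner ℝ w ((K - L) v) ≤ ‖w‖ * ‖(K - L) v‖ := real_inner_le_norm _ _
    _ ≤ ‖w‖ * (‖K - L‖ * ‖v‖) := by gcongr; exact (K - L).le_opNorm v
    _ = _ := by ring

/-- Upper half of Weyl's inequality. -/
theorem IsSpectrum.le_add_norm_sub {L K : H →L[ℝ] H} {lamhat : Fin n → ℝ} {φhat : Fin n → H}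
    (h : IsSpectrum L lamhat φhat) (φ : HilbertBasis ℕ ℝ H) {lam : ℕ → ℝ}
    (hK : ∀ v k, inner ℝ (φ k) (K v) = lam k * inner ℝ (φ k) v) (hlam : Antitone lam)
    (j : Fin n) : lamhat j ≤ lam j + ‖L - K‖ := by
  -- A unit vector spanned by the first `j + 1` empirical eigenvectors and orthogonal to the first
  -- `j` true ones has empirical form at least `lamhat j` and true form at most `lam j`.
  let V : Submodule ℝ H :=
    Submodule.span ℝ (Set.range fun i : Fin (j.val + 1) => φhat (i.castLE j.2))
  have hon : Orthonormal ℝ (fun i : Fin (j.val + 1) => φhat (i.castLE j.2)) :=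
    h.orthonormal.comp _ (Fin.castLE_injective _)
  have hV : Module.finrank ℝ V = j.val + 1 := by
    simpa using finrank_span_eq_card hon.linearIndependent
  have : FiniteDimensional ℝ V := FiniteDimensional.span_of_finite ℝ (Set.finite_range _)
  obtain ⟨v, hv, hv1, hψ⟩ := exists_norm_eq_one_mem_orthogonal V
    (fun i : Fin j.val => φ i) (by rw [hV]; exact Nat.lt_succ_self _)
  have h1 : inner ℝ v (K v) ≤ lam j * ‖v‖ ^ 2 :=
    inner_apply_le_of_eigen φ hK hlam j fun i hi => hψ ⟨i, hi⟩
  have h2 : lamhat j ≤ inner ℝ v (L v) := by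
    obtain ⟨c, hc⟩ := (Submodule.mem_span_range_iff_exists_fun ℝ).1 hv
    have hsum : ∑ i, c i ^ 2 = 1 := by
      have := hon.inner_sum c c Finset.univ
      rw [hc, real_inner_self_eq_norm_sq, hv1] at this
      simpa [pow_two] using this.symm
    have hinner : inner ℝ v (L v) = ∑ i, lamhat (i.castLE j.2) * c i ^ 2 := by
      conv_lhs => rw [← hc]
      rw [sum_inner]
      refine Finset.sum_congr rfl fun i _ => ?_
      rw [real_inner_smul_left, h.inner_eq, hc]
      have : inner ℝ (φhat (i.castLE j.2)) v = c i := by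
        rw [← hc]
        exact hon.inner_right_fintype c i
      rw [this]
      ring
    rw [hinner]
    calc lamhat j = ∑ i, lamhat j * c i ^ 2 := by rw [← Finset.mul_sum, hsum, mul_one]
      _ ≤ _ := by
        refine Finset.sum_le_sum fun i _ => mul_le_mul_of_nonneg_right (h.antitone ?_) (sq_nonneg _)
        rw [Fin.le_def]
        exact Nat.lt_succ_iff.1 i.2
  have h3 := inner_apply_sub_le L K v v
  rw [hv1] at h1 h3
  linarith

/-- A coefficient along an eigenvector of `K` is almost seen by the leading empirical
eigenvectors, when the empirical operator is close to `K`. -/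
theorem IsSpectrum.sum_inner_sq_ge {L K : H →L[ℝ] H} {lamhat : Fin n → ℝ} {φhat : Fin n → H}
    (h : IsSpectrum L lamhat φhat) (φ : HilbertBasis ℕ ℝ H) {lam : ℕ → ℝ}
    (hK : ∀ v k, inner ℝ (φ k) (K v) = lam k * inner ℝ (φ k) v)
    (hKφ : ∀ k, K (φ k) = lam k • φ k) (hlam : StrictAnti lam)
    {k r : ℕ} (hkr : k < r) (hrn : r < n) (β : H)
    (h1 : ‖L - K‖ ≤ (lam k - lam r) / 4)
    (h2 : ‖L - K‖ * (4 * ‖β‖) ≤ (lam k - lam r) * |inner ℝ β (φ k)|) :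
    (inner ℝ β (φ k) : ℝ) ^ 2 / 4 ≤ ∑ j : Fin n with j.val < r, (inner ℝ (φhat j) β : ℝ) ^ 2 := by
  set δ := lam k - lam r with hδ
  have hδ0 : 0 < δ := sub_pos.2 (hlam hkr)
  set τ := ‖L - K‖ with hτ
  set S := ∑ j : Fin n with j.val < r, (inner ℝ (φhat j) β : ℝ) ^ 2 with hS
  have hweyl : lamhat ⟨r, hrn⟩ ≤ lam r + τ := h.le_add_norm_sub φ hK hlam.antitone ⟨r, hrn⟩
  -- The part of `φ k` missed by the leading empirical eigenvectors. Pairing it with `L (φ k)`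
  -- involves only empirical eigenvalues at most `lam r + τ`, whereas pairing it with `K (φ k)`
  -- gives exactly `lam k * ‖q‖ ^ 2`.
  set q := φ k - ∑ j : Fin n with j.val < r, (inner ℝ (φhat j) (φ k) : ℝ) • φhat j with hq
  have hnorm : ‖φ k‖ = 1 := φ.orthonormal.1 k
  have hφq : ∀ j : Fin n, inner ℝ (φhat j) q = if j.val < r then 0 else inner ℝ (φhat j) (φ k) := by
    intro j
    rw [hq, inner_sub_right, Finset.sum_filter]
    simp_rw [← ite_zero_smul]
    rw [h.orthonormal.inner_right_fintype]
    split_ifs <;> simp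
  have hqq : inner ℝ q (φ k) = ‖q‖ ^ 2 := by
    rw [← real_inner_self_eq_norm_sq]
    conv_rhs => rw [hq, inner_sub_left]
    rw [← hq, sum_inner, real_inner_comm]
    rw [Finset.sum_eq_zero, sub_zero]
    intro j hj
    rw [real_inner_smul_left, hφq, if_pos (Finset.mem_filter.1 hj).2, mul_zero]
  have hLq : inner ℝ q (L (φ k)) ≤ (lam r + τ) * ‖q‖ ^ 2 := by
    rw [h.inner_apply_eq_sum]
    calc ∑ j, lamhat j * (inner ℝ (φhat j) (φ k) * inner ℝ (φhat j) q)
        ≤ ∑ j, (lam r + τ) * (inner ℝ (φhat j) q : ℝ) ^ 2 := by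
          refine Finset.sum_le_sum fun j _ => ?_
          by_cases hj : j.val < r
          · rw [hφq, if_pos hj]
            simp
          · have e : inner ℝ (φhat j) (φ k) = inner ℝ (φhat j) q := by rw [hφq, if_neg hj]
            rw [e, ← pow_two]
            refine mul_le_mul_of_nonneg_right (le_trans (h.antitone ?_) hweyl) (sq_nonneg _)
            exact not_lt.1 hj
      _ = (lam r + τ) * ∑ j, (inner ℝ (φhat j) q : ℝ) ^ 2 := by rw [Finset.mul_sum]
      _ ≤ _ := by
          refine mul_le_mul_of_nonneg_left (sum_inner_sq_le h.orthonormal _ _) ?_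
          exact (h.nonneg _).trans hweyl
  have hKq : inner ℝ q (K (φ k)) = lam k * ‖q‖ ^ 2 := by
    rw [hKφ, inner_smul_right, hqq]
  have hdiff : inner ℝ q (K (φ k)) - inner ℝ q (L (φ k)) ≤ τ * ‖q‖ := by
    have := inner_apply_sub_le K L (φ k) q
    rwa [hnorm, mul_one, norm_sub_rev] at this
  have hτ0 : 0 ≤ τ := norm_nonneg _
  -- The two pairings differ by at most `τ * ‖q‖`, so `(δ - τ) * ‖q‖ ≤ τ`; the assumption `τ ≤ δ /
  -- 4` absorbs the left-hand `τ`.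
  have hq2 : δ / 2 * ‖q‖ ≤ τ := by
    rcases (norm_nonneg q).eq_or_lt with h0 | h0
    · rw [← h0, mul_zero]
      exact hτ0
    · have : (δ - τ) * ‖q‖ * ‖q‖ ≤ τ * ‖q‖ := by nlinarith
      have := le_of_mul_le_mul_right this h0
      nlinarith
  have hβ : inner ℝ β (φ k) = inner ℝ β q +
      ∑ j : Fin n with j.val < r, (inner ℝ (φhat j) β * inner ℝ (φhat j) (φ k) : ℝ) := by
    rw [hq, inner_sub_right, inner_sum, sub_add_eq_add_sub, eq_sub_iff_add_eq]
    congr 1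
    refine Finset.sum_congr rfl fun j _ => ?_
    rw [inner_smul_right, real_inner_comm β]
    ring
  have hcs : |∑ j : Fin n with j.val < r, (inner ℝ (φhat j) β * inner ℝ (φhat j) (φ k) : ℝ)| ^ 2
      ≤ S := by
    rw [sq_abs]
    refine (Finset.sum_mul_sq_le_sq_mul_sq _ _ _).trans ?_
    refine (mul_le_mul_of_nonneg_left (sum_inner_sq_le h.orthonormal _ (φ k)) ?_).trans ?_
    · exact Finset.sum_nonneg fun j _ => sq_nonneg _
    · rw [hnorm, one_pow, mul_one]
  set R := ∑ j : Fin n with j.val < r, (inner ℝ (φhat j) β * inner ℝ (φhat j) (φ k) : ℝ) with hR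
  have hbq : |inner ℝ β q| ≤ |inner ℝ β (φ k)| / 2 := by
    refine (abs_real_inner_le_norm β q).trans ?_
    have : δ * (‖β‖ * ‖q‖) ≤ δ * (|inner ℝ β (φ k)| / 2) := by
      nlinarith [mul_le_mul_of_nonneg_left hq2 (norm_nonneg β)]
    exact le_of_mul_le_mul_left this hδ0
  have hRge : |inner ℝ β (φ k)| / 2 ≤ |R| := by
    have : |inner ℝ β (φ k)| ≤ |inner ℝ β q| + |R| := by
      conv_lhs => rw [hβ]
      exact abs_add_le _ _
    linarith
  calc (inner ℝ β (φ k) : ℝ) ^ 2 / 4 = (|inner ℝ β (φ k)| / 2) ^ 2 := by rw [div_pow, sq_abs]; norm_num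
    _ ≤ |R| ^ 2 := by gcongr
    _ ≤ S := hcs

end Perturbation

end

end HybridReg

namespace HybridReg

noncomputable section

/-! ### Algebra of the sample: centring, coefficient errors, a bound on the Tikhonov estimator. -/

section SampleIdentities

variable {H : Type*} [NormedAddCommGroup H] [InnerProductSpace ℝ H] {n : ℕ}

theorem sum_sub_sampleMean {E : Type*} [AddCommGroup E] [Module ℝ E] (x : Fin n → E) :
    ∑ i, (x i - sampleMean x) = 0 := by
  rcases Nat.eq_zero_or_pos n with rfl | hn
  · simp
  · have : (n : ℝ) ≠ 0 := by positivity
    rw [Finset.sum_sub_distrib, Finset.sum_const, Finset.card_univ, Fintype.card_fin, sampleMean,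
      ← Nat.cast_smul_eq_nsmul ℝ, smul_smul, mul_inv_cancel₀ this, one_smul, sub_self]

theorem inner_sampleMean (z : H) (x : Fin n → H) :
    inner ℝ z (sampleMean x) = sampleMean fun i => (inner ℝ z (x i) : ℝ) := by
  rw [sampleMean, inner_smul_right, inner_sum, sampleMean, smul_eq_mul]

theorem natCast_mul_sampleMean (t : Fin n → ℝ) : (n : ℝ) * sampleMean t = ∑ i, t i := by
  have := sum_sub_sampleMean t
  rw [Finset.sum_sub_distrib] at this
  simp at this
  linarith

theorem sum_sub_sampleMean_sq (t : Fin n → ℝ) :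
    ∑ i, (t i - sampleMean t) ^ 2 = ∑ i, t i ^ 2 - n * sampleMean t ^ 2 := by
  have h := natCast_mul_sampleMean t
  simp only [sub_sq, Finset.sum_add_distrib, Finset.sum_sub_distrib, ← Finset.sum_mul,
    ← Finset.mul_sum, Finset.sum_const, Finset.card_univ, Fintype.card_fin, nsmul_eq_mul, ← h]
  ring

theorem sum_sub_sampleMean_sq_le (t : Fin n → ℝ) :
    ∑ i, (t i - sampleMean t) ^ 2 ≤ ∑ i, t i ^ 2 := by
  rw [sum_sub_sampleMean_sq]
  have : 0 ≤ (n : ℝ) * sampleMean t ^ 2 := by positivity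
  linarith

theorem sampleMean_sq_le (t : Fin n → ℝ) : sampleMean t ^ 2 ≤ (n : ℝ)⁻¹ * ∑ i, t i ^ 2 := by
  rcases Nat.eq_zero_or_pos n with rfl | hn
  · simp [sampleMean]
  · have hn' : (0 : ℝ) < n := by positivity
    have h := sum_sub_sampleMean_sq t
    have h0 : 0 ≤ ∑ i, (t i - sampleMean t) ^ 2 := Finset.sum_nonneg fun i _ => sq_nonneg _
    rw [inv_mul_eq_div, le_div_iff₀ hn']
    linarith

theorem inner_empCrossCov (z : H) (x : Fin n → H) (y : Fin n → ℝ) :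
    inner ℝ z (empCrossCov x y) =
      (n : ℝ)⁻¹ * ∑ i, (y i - sampleMean y) * inner ℝ z (x i - sampleMean x) := by
  simp only [empCrossCov, inner_smul_right, inner_sum]

theorem sum_inner_sub_sampleMean (z : H) (x : Fin n → H) :
    ∑ i, (inner ℝ z (x i - sampleMean x) : ℝ) = 0 := by
  rw [← inner_sum, sum_sub_sampleMean, inner_zero_right]

/-- Centring one factor is enough. This form keeps the raw covariates, to be compared with the
uncentred empirical covariance; its right-centred twin eliminates the intercept. -/
theorem inner_empCrossCov_left_centred (z : H) (x : Fin n → H) (y : Fin n → ℝ) :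
    inner ℝ z (empCrossCov x y) =
      (n : ℝ)⁻¹ * ∑ i, (y i - sampleMean y) * inner ℝ z (x i) := by
  rw [inner_empCrossCov]
  congr 1
  simp only [inner_sub_right, mul_sub, Finset.sum_sub_distrib (f := fun i => (_ : ℝ) * _)]
  rw [← Finset.sum_mul, sum_sub_sampleMean, zero_mul, sub_zero]

theorem inner_empCrossCov_right_centred (z : H) (x : Fin n → H) (y : Fin n → ℝ) :
    inner ℝ z (empCrossCov x y) =
      (n : ℝ)⁻¹ * ∑ i, y i * inner ℝ z (x i - sampleMean x) := by
  rw [inner_empCrossCov]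
  congr 1
  simp only [sub_mul, Finset.sum_sub_distrib (f := fun i => (_ : ℝ) * _)]
  rw [← Finset.mul_sum, sum_inner_sub_sampleMean, mul_zero, sub_zero]

theorem inner_empCrossCov_model (z : H) (x : Fin n → H) (a : ℝ) (β : H) (e : Fin n → ℝ) :
    inner ℝ z (empCrossCov x fun i => a + inner ℝ (x i) β + e i) =
      inner ℝ z (empCov x β) - inner ℝ (sampleMean x) β * inner ℝ z (sampleMean x)
        + (n : ℝ)⁻¹ * ∑ i, e i * inner ℝ z (x i - sampleMean x) := by
  rw [inner_empCrossCov_right_centred, empCov_apply, inner_smul_right, inner_sum]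
  simp only [add_mul, Finset.sum_add_distrib]
  rw [← Finset.mul_sum, sum_inner_sub_sampleMean, mul_zero, zero_add, mul_add]
  congr 1
  have h1 : inner ℝ (sampleMean x) β = (n : ℝ)⁻¹ * ∑ i, (inner ℝ (x i) β : ℝ) := by
    rw [sampleMean, real_inner_smul_left, sum_inner]
  simp only [inner_sub_right, mul_sub, Finset.sum_sub_distrib (f := fun i => (_ : ℝ) * _),
    inner_smul_right]
  rw [h1, ← Finset.sum_mul]
  ring

/-- The weights of the noise variables in the `j`-th empirical coefficient. -/
def noiseWeight (lam : Fin n → ℝ) (φ : Fin n → H) (x : Fin n → H) (j i : Fin n) : ℝ :=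
  (n : ℝ)⁻¹ * (lam j)⁻¹ * inner ℝ (φ j) (x i - sampleMean x)

variable {x : Fin n → H} {lam : Fin n → ℝ} {φ : Fin n → H}

/-- Centring only decreases a sum of squares, and the uncentred squares along `φ j` sum to `n * lam
j`. -/
theorem IsSpectrum.sum_noiseWeight_sq_le (h : IsSpectrum (empCov x) lam φ) (j : Fin n) :
    ∑ i, noiseWeight lam φ x j i ^ 2 ≤ (n : ℝ)⁻¹ * (lam j)⁻¹ := by
  have hn : (n : ℝ) ≠ 0 := by
    have := j.pos
    positivity
  have h1 : ∑ i, (inner ℝ (φ j) (x i - sampleMean x) : ℝ) ^ 2 ≤ n * lam j := by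
    simp_rw [inner_sub_right, inner_sampleMean]
    refine (sum_sub_sampleMean_sq_le fun i => (inner ℝ (φ j) (x i) : ℝ)).trans (le_of_eq ?_)
    rw [← h.sum_inner_sq j, mul_inv_cancel_left₀ hn]
    simp_rw [real_inner_comm]
  simp only [noiseWeight, mul_pow]
  rw [← Finset.mul_sum]
  refine (mul_le_mul_of_nonneg_left h1 (by positivity)).trans (le_of_eq ?_)
  rcases eq_or_ne (lam j) 0 with h0 | h0
  · simp [h0]
  · field_simp

/-- The error of the `j`-th least squares coefficient along the empirical eigenvectors. -/
theorem IsSpectrum.coefficient_error_sq_le (h : IsSpectrum (empCov x) lam φ) (a : ℝ) (β : H)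
    (e : Fin n → ℝ) (j : Fin n) (hj : 0 < lam j) :
    ((lam j)⁻¹ * inner ℝ (φ j) (empCrossCov x fun i => a + inner ℝ (x i) β + e i)
      - inner ℝ (φ j) β) ^ 2 ≤
      n * (inner ℝ (sampleMean x) β : ℝ) ^ 4 + (n : ℝ)⁻¹ * ((lam j)⁻¹) ^ 2
        + 2 * (∑ i, e i * noiseWeight lam φ x j i) ^ 2 := by
  have hn : (0 : ℝ) < n := by
    have := j.pos
    positivity
  -- The second term is there because the cross-covariance is centred while the empirical covariance
  -- is not.
  have h1 : (lam j)⁻¹ * inner ℝ (φ j) (empCrossCov x fun i => a + inner ℝ (x i) β + e i)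
      - inner ℝ (φ j) β = (∑ i, e i * noiseWeight lam φ x j i)
        - inner ℝ (sampleMean x) β * (inner ℝ (φ j) (sampleMean x) * (lam j)⁻¹) := by
    have h2 : ∑ i, e i * noiseWeight lam φ x j i =
        (lam j)⁻¹ * ((n : ℝ)⁻¹ * ∑ i, e i * inner ℝ (φ j) (x i - sampleMean x)) := by
      simp only [noiseWeight, Finset.mul_sum]
      refine Finset.sum_congr rfl fun i _ => ?_
      ring
    rw [h2, inner_empCrossCov_model, h.inner_eq]
    field_simp
    ring
  have h3 : (inner ℝ (φ j) (sampleMean x) : ℝ) ^ 2 ≤ lam j := by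
    rw [inner_sampleMean, ← h.sum_inner_sq j]
    simp_rw [real_inner_comm (φ j)]
    exact sampleMean_sq_le _
  rw [h1]
  set N := ∑ i, e i * noiseWeight lam φ x j i
  set m : ℝ := inner ℝ (φ j) (sampleMean x)
  set b : ℝ := inner ℝ (sampleMean x) β
  set l := (lam j)⁻¹ with hl
  have hl0 : 0 < l := inv_pos.2 hj
  have h4 : (m * l) ^ 2 ≤ l := by
    have : m ^ 2 * l ≤ 1 := by
      rw [hl, ← div_eq_mul_inv, div_le_one hj]
      exact h3
    nlinarith
  -- AM-GM with weight `n`: the fourth moment of the sample mean is `O(n⁻²)`, so both resulting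
  -- terms have expectation `O(n⁻¹)`.
  have h5 : 2 * (b ^ 2 * l) ≤ n * b ^ 4 + (n : ℝ)⁻¹ * l ^ 2 := by
    have e1 : n * b ^ 4 + (n : ℝ)⁻¹ * l ^ 2 - 2 * (b ^ 2 * l) = (n : ℝ)⁻¹ * (n * b ^ 2 - l) ^ 2 := by
      field_simp
      ring
    have : 0 ≤ (n : ℝ)⁻¹ * (n * b ^ 2 - l) ^ 2 := by positivity
    linarith
  nlinarith [sq_nonneg (N + b * (m * l)), mul_le_mul_of_nonneg_left h4 (sq_nonneg b)]

theorem empCov_add_smul_tikhonov (h : IsSpectrum (empCov x) lam φ) {ρ : ℝ} (hρ : 0 < ρ)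
    (y : Fin n → ℝ) :
    empCov x (tikhonov ρ x y) + ρ • tikhonov ρ x y = empCrossCov x y := by
  rw [tikhonov_eq h hρ]
  set z := diagOp φ (fun j => (lam j + ρ)⁻¹) ρ⁻¹ (empCrossCov x y) with hz
  have h1 : empCov x z + ρ • z = (empCov x + ρ • ContinuousLinearMap.id ℝ H) z := by simp
  rw [h1, h.eq_diagOp, id_eq_diagOp φ, smul_diagOp, diagOp_add, hz, ← mul_apply_eq_comp,
    diagOp_mul h.orthonormal]
  have h2 : (lam + ρ • (1 : Fin n → ℝ)) * (fun j => (lam j + ρ)⁻¹) = 1 := by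
    funext j
    have : 0 < lam j + ρ := add_pos_of_nonneg_of_pos (h.nonneg j) hρ
    simp [this.ne']
  rw [h2, mul_one, zero_add, mul_inv_cancel₀ hρ.ne', ← id_eq_diagOp]
  rfl

/-- Pair the normal equation with its solution `z`: the terms `⟪x i, z⟫ ^ 2` produced by Young's
inequality cancel against the empirical form. The bound involves the responses alone, so their
second moments make the loss integrable. -/
theorem norm_tikhonov_sq_le (h : IsSpectrum (empCov x) lam φ) {ρ : ℝ} (hρ : 0 < ρ)
    (y : Fin n → ℝ) :
    ‖tikhonov ρ x y‖ ^ 2 ≤ ρ⁻¹ * ∑ i, y i ^ 2 := by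
  rcases Nat.eq_zero_or_pos n with rfl | hn
  · have : empCrossCov x y = 0 := by simp [empCrossCov]
    simp [tikhonov, this]
  have hn1 : (1 : ℝ) ≤ n := by exact_mod_cast hn
  set z := tikhonov ρ x y with hz
  have h1 := congrArg (fun u => (inner ℝ z u : ℝ)) (empCov_add_smul_tikhonov h hρ y)
  simp only [← hz, inner_add_right, inner_smul_right, real_inner_self_eq_norm_sq] at h1
  rw [inner_empCov, inner_empCrossCov_left_centred] at h1
  have h2 : ∑ i, (y i - sampleMean y) * inner ℝ z (x i) ≤
      ∑ i, y i ^ 2 + ∑ i, (inner ℝ (x i) z : ℝ) ^ 2 := by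
    calc ∑ i, (y i - sampleMean y) * inner ℝ z (x i)
        ≤ ∑ i, ((y i - sampleMean y) ^ 2 + (inner ℝ (x i) z : ℝ) ^ 2) := by
          refine Finset.sum_le_sum fun i _ => ?_
          rw [real_inner_comm z]
          nlinarith [sq_nonneg (y i - sampleMean y - inner ℝ z (x i)),
            sq_nonneg (y i - sampleMean y), sq_nonneg (inner ℝ z (x i) : ℝ)]
      _ = ∑ i, (y i - sampleMean y) ^ 2 + ∑ i, (inner ℝ (x i) z : ℝ) ^ 2 :=
          Finset.sum_add_distrib
      _ ≤ _ := by gcongr ?_ + _; exact sum_sub_sampleMean_sq_le y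
  have h3 : ρ * ‖z‖ ^ 2 ≤ (n : ℝ)⁻¹ * ∑ i, y i ^ 2 := by
    have := mul_le_mul_of_nonneg_left h2 (by positivity : (0 : ℝ) ≤ (n : ℝ)⁻¹)
    rw [mul_add] at this
    linarith
  have h4 : (n : ℝ)⁻¹ * ∑ i, y i ^ 2 ≤ ∑ i, y i ^ 2 :=
    mul_le_of_le_one_left (Finset.sum_nonneg fun i _ => sq_nonneg _) (inv_le_one_of_one_le₀ hn1)
  rw [inv_mul_eq_div, le_div_iff₀ hρ, mul_comm]
  exact h3.trans h4

end SampleIdentities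

end

end HybridReg

namespace HybridReg

noncomputable section

/-! ### Negative moments of real Gaussians. -/

section SmallBall

open scoped ENNReal NNReal

theorem lintegral_enorm_rpow_unitInterval_lt_top :
    ∫⁻ t in Metric.ball (0 : ℝ) 1, ‖t‖ₑ ^ (-(1 / 2) : ℝ) < ∞ := by
  have hmeas : Measurable fun t : ℝ => ‖t‖ ^ (-(1 / 2) : ℝ) := by fun_prop
  have h : IntegrableOn (fun t : ℝ => ‖t‖ ^ (-(1 / 2) : ℝ)) (Metric.ball (0 : ℝ) 1) := by
    refine integrableOn_ball_of_norm_le_rpow (C := 1) (α := 1 / 2) (by simp) (by norm_num) ?_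
      hmeas.aestronglyMeasurable
    refine Eventually.of_forall fun t => ?_
    rw [one_mul, Real.norm_of_nonneg (by positivity)]
  have h2 := h.2
  rw [HasFiniteIntegral] at h2
  refine lt_of_le_of_lt (le_of_eq ?_) h2
  refine lintegral_congr_ae (ae_restrict_of_ae ?_)
  have h0 : ∀ᵐ t : ℝ, t ≠ 0 := by
    simp [ae_iff]
  filter_upwards [h0] with t ht
  have hpos : 0 < ‖t‖ := norm_pos_iff.2 ht
  rw [Real.enorm_of_nonneg (by positivity : 0 ≤ ‖t‖ ^ (-(1 / 2) : ℝ)),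
    ← ENNReal.ofReal_rpow_of_pos hpos, ofReal_norm]

/-- Negative moments of a centred real Gaussian are bounded as long as its variance stays away
from `0`. -/
theorem exists_lintegral_enorm_rpow_gaussianReal_le {s : ℝ} (hs : 0 < s) :
    ∃ M : ℝ≥0∞, M ≠ ∞ ∧ ∀ v : ℝ≥0, s ≤ v →
      ∫⁻ t, ‖t‖ₑ ^ (-(1 / 2) : ℝ) ∂(gaussianReal 0 v) ≤ M := by
  -- Off the unit ball the integrand is at most `1`; on it the density is at most `(√(2πs))⁻¹`.
  refine ⟨1 + ENNReal.ofReal (√(2 * Real.pi * s))⁻¹ *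
    ∫⁻ t in Metric.ball (0 : ℝ) 1, ‖t‖ₑ ^ (-(1 / 2) : ℝ), ?_, fun v hv => ?_⟩
  · exact ENNReal.add_ne_top.2 ⟨ENNReal.one_ne_top,
      ENNReal.mul_ne_top ENNReal.ofReal_ne_top lintegral_enorm_rpow_unitInterval_lt_top.ne⟩
  have hv0 : v ≠ 0 := by
    rintro rfl
    simp at hv
    linarith
  have hmeas : Measurable fun t : ℝ => ‖t‖ₑ ^ (-(1 / 2) : ℝ) := by fun_prop
  have h1 : ∀ t : ℝ, ‖t‖ₑ ^ (-(1 / 2) : ℝ) ≤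
      1 + (Metric.ball (0 : ℝ) 1).indicator (fun t => ‖t‖ₑ ^ (-(1 / 2) : ℝ)) t := by
    intro t
    by_cases ht : t ∈ Metric.ball (0 : ℝ) 1
    · rw [Set.indicator_of_mem ht]
      exact le_add_self
    · rw [Set.indicator_of_notMem ht, add_zero]
      have h1t : (1 : ℝ≥0∞) ≤ ‖t‖ₑ := by
        rw [← ofReal_norm, ENNReal.one_le_ofReal]
        simpa using ht
      exact ENNReal.rpow_le_one_of_one_le_of_neg h1t (by norm_num)
  calc ∫⁻ t, ‖t‖ₑ ^ (-(1 / 2) : ℝ) ∂(gaussianReal 0 v)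
      ≤ ∫⁻ t, (1 + (Metric.ball (0 : ℝ) 1).indicator (fun t => ‖t‖ₑ ^ (-(1 / 2) : ℝ)) t)
          ∂(gaussianReal 0 v) := lintegral_mono h1
    _ = 1 + ∫⁻ t in Metric.ball (0 : ℝ) 1, ‖t‖ₑ ^ (-(1 / 2) : ℝ) ∂(gaussianReal 0 v) := by
        rw [lintegral_add_left measurable_const, lintegral_indicator measurableSet_ball]
        simp
    _ ≤ _ := by
        gcongr
        rw [gaussianReal_of_var_ne_zero _ hv0, setLIntegral_withDensity_eq_setLIntegral_mul _
          (measurable_gaussianPDF 0 v) hmeas measurableSet_ball,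
          ← lintegral_const_mul _ hmeas]
        refine lintegral_mono fun t => ?_
        rw [Pi.mul_apply]
        gcongr
        rw [gaussianPDF]
        refine ENNReal.ofReal_le_ofReal ?_
        rw [gaussianPDFReal]
        have hexp : Real.exp (-(t - 0) ^ 2 / (2 * v)) ≤ 1 := by
          rw [Real.exp_le_one_iff]
          have : 0 ≤ (t - 0) ^ 2 / (2 * (v : ℝ)) := by positivity
          rw [neg_div]
          linarith
        refine (mul_le_of_le_one_right (by positivity) hexp).trans ?_
        gcongr

end SmallBall

/-! ### Inverse moments of a random quadratic form, uniformly over a sphere. -/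

section InverseMoment

open scoped ENNReal NNReal

variable {H : Type*} [NormedAddCommGroup H] [InnerProductSpace ℝ H] {N : ℕ}

/-- The quadratic form `∑ᵢ ⟪xᵢ, v⟫²`. -/
def sampleForm (x : Fin N → H) (v : H) : ℝ := ∑ i, (inner ℝ (x i) v : ℝ) ^ 2

theorem sampleForm_nonneg (x : Fin N → H) (v : H) : 0 ≤ sampleForm x v :=
  Finset.sum_nonneg fun _ _ => sq_nonneg _

theorem sampleForm_le (x : Fin N → H) (v : H) : sampleForm x v ≤ (∑ i, ‖x i‖ ^ 2) * ‖v‖ ^ 2 := by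
  rw [sampleForm, Finset.sum_mul]
  refine Finset.sum_le_sum fun i _ => ?_
  rw [← mul_pow, ← sq_abs]
  gcongr
  exact abs_real_inner_le_norm _ _

theorem sampleForm_add_le (x : Fin N → H) (v w : H) :
    sampleForm x (v + w) ≤ 2 * sampleForm x v + 2 * sampleForm x w := by
  simp only [sampleForm, Finset.mul_sum]
  rw [← Finset.sum_add_distrib]
  refine Finset.sum_le_sum fun i _ => ?_
  rw [inner_add_right]
  nlinarith [sq_nonneg ((inner ℝ (x i) v : ℝ) - inner ℝ (x i) w)]

/-- Each `⟪x i, v⟫ ^ 2` is at most the whole form, so `8 * p` factors of power `1/4` multiply up to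
at most its `p`-th power. A negative power of a sum becomes a product over independent observations,
each with an integrable exponent. -/
theorem prod_enorm_rpow_le (x : Fin N → H) (v : H) {p : ℕ} (hN : N = 8 * p) :
    ((ENNReal.ofReal (sampleForm x v))⁻¹) ^ p ≤
      ∏ i, ‖(inner ℝ (x i) v : ℝ)‖ₑ ^ (-(1 / 4) : ℝ) := by
  set Q := ENNReal.ofReal (sampleForm x v) with hQ
  have h1 : ∀ i, ‖(inner ℝ (x i) v : ℝ)‖ₑ ^ (1 / 4 : ℝ) ≤ Q ^ (1 / 8 : ℝ) := by
    intro i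
    have h2 : ‖(inner ℝ (x i) v : ℝ)‖ₑ ^ (2 : ℝ) ≤ Q := by
      rw [hQ, ENNReal.rpow_ofNat, ← ofReal_norm, ← ENNReal.ofReal_pow (norm_nonneg _)]
      refine ENNReal.ofReal_le_ofReal ?_
      rw [Real.norm_eq_abs, sq_abs]
      exact Finset.single_le_sum (f := fun i => (inner ℝ (x i) v : ℝ) ^ 2)
        (fun _ _ => sq_nonneg _) (Finset.mem_univ i)
    have h3 := ENNReal.rpow_le_rpow h2 (by norm_num : (0 : ℝ) ≤ 1 / 8)
    rw [← ENNReal.rpow_mul] at h3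
    norm_num at h3 ⊢
    exact h3
  have h2 : ∏ i, ‖(inner ℝ (x i) v : ℝ)‖ₑ ^ (1 / 4 : ℝ) ≤ Q ^ p := by
    refine (Finset.prod_le_prod' fun i _ => h1 i).trans (le_of_eq ?_)
    rw [Finset.prod_const, Finset.card_univ, Fintype.card_fin, hN, ← ENNReal.rpow_natCast,
      ← ENNReal.rpow_mul, ← ENNReal.rpow_natCast]
    congr 1
    push_cast
    ring
  rw [← ENNReal.inv_pow]
  refine (ENNReal.inv_le_inv.2 h2).trans (le_of_eq ?_)
  rw [ENNReal.prod_inv_distrib]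
  · simp_rw [ENNReal.rpow_neg]
  · intro i _ j _ _
    right
    exact ENNReal.rpow_ne_top_of_nonneg (by norm_num) enorm_ne_top

/-- A product over `i` is needed so that independence can factor the expectation; `A * B ≤ A² + B²`
then separates the norm from the small-ball term and doubles the exponent `-1/4` to `-1/2`. -/
theorem inverseBound_integrand_le (x : Fin N → H) (v : H) (d : ℕ) (hN : N = 8 * (d + 2)) :
    (1 + ∑ i, ‖x i‖ₑ ^ 2) ^ d * ((ENNReal.ofReal (sampleForm x v))⁻¹) ^ (d + 2) ≤
      ∏ i, ((1 + ‖x i‖ₑ ^ 2) ^ (2 * d) + ‖(inner ℝ (x i) v : ℝ)‖ₑ ^ (-(1 / 2) : ℝ)) := by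
  have h1 : (1 + ∑ i, ‖x i‖ₑ ^ 2) ≤ ∏ i, (1 + ‖x i‖ₑ ^ 2) := by
    have : ∀ s : Finset (Fin N), (1 + ∑ i ∈ s, ‖x i‖ₑ ^ 2) ≤ ∏ i ∈ s, (1 + ‖x i‖ₑ ^ 2) := by
      intro s
      induction s using Finset.cons_induction with
      | empty => simp
      | cons j s hj ih =>
        rw [Finset.sum_cons, Finset.prod_cons, add_mul, one_mul]
        have h1 : (1 : ℝ≥0∞) ≤ ∏ i ∈ s, (1 + ‖x i‖ₑ ^ 2) := le_self_add.trans ih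
        calc 1 + (‖x j‖ₑ ^ 2 + ∑ i ∈ s, ‖x i‖ₑ ^ 2)
            = (1 + ∑ i ∈ s, ‖x i‖ₑ ^ 2) + ‖x j‖ₑ ^ 2 * 1 := by ring
          _ ≤ _ := by gcongr
    exact this Finset.univ
  calc (1 + ∑ i, ‖x i‖ₑ ^ 2) ^ d * ((ENNReal.ofReal (sampleForm x v))⁻¹) ^ (d + 2)
      ≤ (∏ i, (1 + ‖x i‖ₑ ^ 2)) ^ d * ∏ i, ‖(inner ℝ (x i) v : ℝ)‖ₑ ^ (-(1 / 4) : ℝ) := by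
        gcongr
        exact prod_enorm_rpow_le x v hN
    _ = ∏ i, ((1 + ‖x i‖ₑ ^ 2) ^ d * ‖(inner ℝ (x i) v : ℝ)‖ₑ ^ (-(1 / 4) : ℝ)) := by
        rw [← Finset.prod_pow, ← Finset.prod_mul_distrib]
    _ ≤ _ := by
        refine Finset.prod_le_prod' fun i _ => ?_
        have e : ‖(inner ℝ (x i) v : ℝ)‖ₑ ^ (-(1 / 2) : ℝ) =
            (‖(inner ℝ (x i) v : ℝ)‖ₑ ^ (-(1 / 4) : ℝ)) ^ 2 := by
          rw [← ENNReal.rpow_natCast, ← ENNReal.rpow_mul]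
          norm_num
        rw [e, mul_comm 2 d, pow_mul]
        set A := (1 + ‖x i‖ₑ ^ 2) ^ d
        set B := ‖(inner ℝ (x i) v : ℝ)‖ₑ ^ (-(1 / 4) : ℝ)
        rcases le_total A B with h | h
        · exact (mul_le_mul_left h B).trans (by rw [← pow_two]; exact le_add_self)
        · exact (mul_le_mul_right h A).trans (by rw [← pow_two]; exact le_self_add)

/-- The annulus `1 / 2 ≤ ‖v‖ ≤ 2`. -/
def annulus (E : Type*) [Norm E] : Set E := {v | 1 / 2 ≤ ‖v‖ ∧ ‖v‖ ≤ 2}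

variable [MeasurableSpace H] [BorelSpace H] (V : Submodule ℝ H)

theorem measurableSet_annulus : MeasurableSet (annulus V) :=
  (measurableSet_le measurable_const measurable_norm).inter
    (measurableSet_le measurable_norm measurable_const)

theorem measurable_sampleForm [SecondCountableTopology H] :
    Measurable fun p : (Fin N → H) × V => sampleForm p.1 (p.2 : H) := by
  unfold sampleForm
  fun_prop

theorem measurable_inverseBound_integrand [SecondCountableTopology H] :
    Measurable fun p : (Fin N → H) × V => (1 + ∑ i, ‖p.1 i‖ₑ ^ 2) ^ Module.finrank ℝ V *
      ((ENNReal.ofReal (sampleForm p.1 (p.2 : H)))⁻¹) ^ (Module.finrank ℝ V + 2) := by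
  have := measurable_sampleForm (N := N) V
  fun_prop

variable [FiniteDimensional ℝ V]

/-- A dominating function for the inverse square of the smallest value of the quadratic form
`sampleForm x` on the unit sphere of `V`. -/
def inverseBound (x : Fin N → H) : ℝ≥0∞ :=
  ENNReal.ofReal (4 ^ (Module.finrank ℝ V + 2) * 2 ^ Module.finrank ℝ V) *
      (volume (Metric.ball (0 : V) 1))⁻¹ *
    ∫⁻ v in annulus V, (1 + ∑ i, ‖x i‖ₑ ^ 2) ^ Module.finrank ℝ V *
      ((ENNReal.ofReal (sampleForm x v))⁻¹) ^ (Module.finrank ℝ V + 2)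

theorem volume_annulus_ne_top : volume (annulus V) ≠ ∞ := by
  refine ((measure_mono (t := Metric.closedBall (0 : V) 2) fun v hv => ?_).trans_lt
    measure_closedBall_lt_top).ne
  simpa using hv.2

/-- Write `T` for `1 + ∑ ‖x i‖²`. The form stays below `4 t` on a ball of radius of order `t / T`
around `u`, so the integral is at least of order `T^d t^(-(d+2)) (t / T)^d = t⁻²`. This explains the
weight and the exponent `d + 2` in `inverseBound`. The free parameter `t` covers a form that
vanishes at `u`. -/
theorem inv_sq_le_inverseBound_of_le (x : Fin N → H) (u : V) (hu : ‖u‖ = 1) {t : ℝ} (ht : 0 < t)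
    (hut : sampleForm x u ≤ t) (htT : t ≤ 1 + ∑ i, ‖x i‖ ^ 2) :
    ((ENNReal.ofReal t)⁻¹) ^ 2 ≤ inverseBound V x := by
  set d := Module.finrank ℝ V with hd
  set T : ℝ := 1 + ∑ i, ‖x i‖ ^ 2 with hT
  have hS0 : 0 ≤ ∑ i, ‖x i‖ ^ 2 := Finset.sum_nonneg fun _ _ => sq_nonneg _
  have hT0 : 0 < T := by positivity
  have hTe : 1 + ∑ i, ‖x i‖ₑ ^ 2 = ENNReal.ofReal T := by
    rw [hT, ENNReal.ofReal_add zero_le_one hS0, ENNReal.ofReal_one,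
      ENNReal.ofReal_sum_of_nonneg fun _ _ => sq_nonneg _]
    congr 1
    refine Finset.sum_congr rfl fun i _ => ?_
    rw [ENNReal.ofReal_pow (norm_nonneg _), ofReal_norm]
  -- With this radius the form of `v - u` is at most `t / 2`, so the form of `v` is at most `2 t +
  -- t`.
  set δ := t / (2 * T) with hδ
  have hδ0 : 0 < δ := by positivity
  have hδ1 : δ ≤ 1 / 2 := by
    rw [hδ, div_le_iff₀ (by positivity)]
    linarith
  have hTδ : T * δ = t / 2 := by rw [hδ]; field_simp
  have hball : ∀ v ∈ Metric.closedBall u δ, v ∈ annulus V ∧ sampleForm x v ≤ 4 * t := by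
    intro v hv
    rw [mem_closedBall_iff_norm] at hv
    refine ⟨⟨?_, ?_⟩, ?_⟩
    · have := norm_sub_norm_le u v
      rw [hu, norm_sub_rev] at this
      linarith
    · have := norm_sub_norm_le v u
      rw [hu] at this
      linarith
    · have h1 : (v : H) = u + ((v - u : V) : H) := by simp
      have h2 : sampleForm x ((v - u : V) : H) ≤ t / 2 := by
        refine (sampleForm_le x _).trans ?_
        have h3 : ‖((v - u : V) : H)‖ ≤ δ := hv
        have h4 : ‖((v - u : V) : H)‖ ^ 2 ≤ δ * 1 := by
          rw [pow_two]
          exact mul_le_mul h3 (by linarith) (norm_nonneg _) hδ0.le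
        calc (∑ i, ‖x i‖ ^ 2) * ‖((v - u : V) : H)‖ ^ 2 ≤ T * (δ * 1) := by
              gcongr
              linarith
          _ = t / 2 := by rw [mul_one, hTδ]
      rw [h1]
      refine (sampleForm_add_le x _ _).trans ?_
      linarith
  have hB0 : volume (Metric.ball (0 : V) 1) ≠ 0 := (Metric.measure_ball_pos _ _ one_pos).ne'
  have hB1 : volume (Metric.ball (0 : V) 1) ≠ ∞ := measure_ball_lt_top.ne
  have hint : ENNReal.ofReal T ^ d * (ENNReal.ofReal (4 * t))⁻¹ ^ (d + 2) *
      (ENNReal.ofReal (δ ^ d) * volume (Metric.ball (0 : V) 1)) ≤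
      ∫⁻ v in annulus V, (1 + ∑ i, ‖x i‖ₑ ^ 2) ^ d *
        ((ENNReal.ofReal (sampleForm x v))⁻¹) ^ (d + 2) := by
    rw [← Measure.addHaar_closedBall volume u hδ0.le, ← setLIntegral_const]
    refine (setLIntegral_mono' measurableSet_closedBall fun v hv => ?_).trans
      (lintegral_mono_set fun v hv => (hball v hv).1)
    rw [hTe]
    gcongr
    exact (hball v hv).2
  rw [inverseBound]
  refine le_trans (le_of_eq ?_) (mul_le_mul_right hint _)
  have e1 : (ENNReal.ofReal t)⁻¹ ^ 2 = ENNReal.ofReal ((t⁻¹) ^ 2) := by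
    rw [← ENNReal.ofReal_inv_of_pos ht, ENNReal.ofReal_pow (by positivity)]
  have e2 : ENNReal.ofReal T ^ d * (ENNReal.ofReal (4 * t))⁻¹ ^ (d + 2) =
      ENNReal.ofReal (T ^ d * ((4 * t)⁻¹) ^ (d + 2)) := by
    rw [← ENNReal.ofReal_inv_of_pos (by positivity), ENNReal.ofReal_mul (by positivity),
      ENNReal.ofReal_pow (by positivity), ENNReal.ofReal_pow (by positivity)]
  have e3 : ENNReal.ofReal (4 ^ (d + 2) * 2 ^ d) * (volume (Metric.ball (0 : V) 1))⁻¹ *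
      (ENNReal.ofReal (T ^ d * ((4 * t)⁻¹) ^ (d + 2)) *
        (ENNReal.ofReal (δ ^ d) * volume (Metric.ball (0 : V) 1))) =
      ENNReal.ofReal (4 ^ (d + 2) * 2 ^ d) * ENNReal.ofReal (T ^ d * ((4 * t)⁻¹) ^ (d + 2)) *
        ENNReal.ofReal (δ ^ d) *
        ((volume (Metric.ball (0 : V) 1))⁻¹ * volume (Metric.ball (0 : V) 1)) := by ring
  rw [e1, e2, e3, ENNReal.inv_mul_cancel hB0 hB1, mul_one,
    ← ENNReal.ofReal_mul (by positivity), ← ENNReal.ofReal_mul (by positivity)]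
  congr 1
  rw [hδ, mul_inv, mul_pow, div_pow, mul_pow, pow_add t⁻¹, inv_pow, inv_pow, inv_pow]
  field_simp

theorem inv_sq_le_inverseBound (x : Fin N → H) {u : H} (huV : u ∈ V) (hu : ‖u‖ = 1) :
    ((ENNReal.ofReal (sampleForm x u))⁻¹) ^ 2 ≤ inverseBound V x := by
  have hS0 : 0 ≤ ∑ i, ‖x i‖ ^ 2 := Finset.sum_nonneg fun _ _ => sq_nonneg _
  rcases (sampleForm_nonneg x u).eq_or_lt with h0 | h0
  · have htop : inverseBound V x = ∞ := by
      refine ENNReal.eq_top_of_forall_nnreal_le fun s => ?_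
      have h1 : ((s : ℝ) + 1)⁻¹ ≤ 1 := inv_le_one_of_one_le₀ (by simp)
      have h2 := inv_sq_le_inverseBound_of_le V x ⟨u, huV⟩ (by simpa using hu)
        (t := ((s : ℝ) + 1)⁻¹) (by positivity) (by simp only [← h0]; positivity) (by linarith)
      refine le_trans ?_ h2
      rw [ENNReal.ofReal_inv_of_pos (by positivity), inv_inv, ← ENNReal.ofReal_pow (by positivity),
        ← ENNReal.ofReal_coe_nnreal]
      refine ENNReal.ofReal_le_ofReal ?_
      nlinarith [s.2]
    rw [htop]
    exact le_top
  · refine inv_sq_le_inverseBound_of_le V x ⟨u, huV⟩ (by simpa using hu) h0 le_rfl ?_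
    refine (sampleForm_le x u).trans ?_
    rw [hu]
    linarith

variable [SecondCountableTopology H]

theorem measurable_inverseBound : Measurable (inverseBound V : (Fin N → H) → ℝ≥0∞) :=
  ((measurable_inverseBound_integrand V).lintegral_prod_right'
    (ν := volume.restrict (annulus V))).const_mul _

/-- Tonelli moves the expectation inside the integral over the annulus, where independence bounds it
by `M' ^ N` uniformly in `v`; the annulus has finite volume. -/
theorem lintegral_inverseBound_lt_top (μ : Measure H) [IsProbabilityMeasure μ]
    (hN : N = 8 * (Module.finrank ℝ V + 2))
    (hmom : ∫⁻ x, (1 + ‖x‖ₑ ^ 2) ^ (2 * Module.finrank ℝ V) ∂μ ≠ ∞) {M : ℝ≥0∞} (hM : M ≠ ∞)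
    (hsb : ∀ v ∈ annulus V, ∫⁻ x, ‖(inner ℝ x (v : H) : ℝ)‖ₑ ^ (-(1 / 2) : ℝ) ∂μ ≤ M) :
    ∫⁻ x, inverseBound V x ∂(Measure.pi fun _ : Fin N => μ) < ∞ := by
  have hB0 : volume (Metric.ball (0 : V) 1) ≠ 0 := (Metric.measure_ball_pos _ _ one_pos).ne'
  set M' := ∫⁻ x, (1 + ‖x‖ₑ ^ 2) ^ (2 * Module.finrank ℝ V) ∂μ + M with hM'
  have hM't : M' ≠ ∞ := ENNReal.add_ne_top.2 ⟨hmom, hM⟩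
  simp only [inverseBound]
  rw [lintegral_const_mul _ ((measurable_inverseBound_integrand V).lintegral_prod_right'
    (ν := volume.restrict (annulus V)))]
  refine ENNReal.mul_lt_top (ENNReal.mul_lt_top ENNReal.ofReal_lt_top
    (ENNReal.inv_lt_top.2 (pos_iff_ne_zero.2 hB0))) ?_
  rw [lintegral_lintegral_swap (measurable_inverseBound_integrand V).aemeasurable]
  have hbound : ∀ v ∈ annulus V, ∫⁻ x : Fin N → H, (1 + ∑ i, ‖x i‖ₑ ^ 2) ^ Module.finrank ℝ V *
      ((ENNReal.ofReal (sampleForm x v))⁻¹) ^ (Module.finrank ℝ V + 2)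
        ∂(Measure.pi fun _ : Fin N => μ) ≤ M' ^ N := by
    intro v hv
    refine (lintegral_mono fun x => inverseBound_integrand_le x (v : H) _ hN).trans ?_
    have hmeas : Measurable fun x : H => (1 + ‖x‖ₑ ^ 2) ^ (2 * Module.finrank ℝ V) +
        ‖(inner ℝ x (v : H) : ℝ)‖ₑ ^ (-(1 / 2) : ℝ) := by fun_prop
    rw [lintegral_prod_eq_prod_lintegral_of_indepFun Finset.univ
      (fun i (x : Fin N → H) => (1 + ‖x i‖ₑ ^ 2) ^ (2 * Module.finrank ℝ V) +
        ‖(inner ℝ (x i) (v : H) : ℝ)‖ₑ ^ (-(1 / 2) : ℝ))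
      (iIndepFun_pi (X := fun _ (x : H) => (1 + ‖x‖ₑ ^ 2) ^ (2 * Module.finrank ℝ V) +
        ‖(inner ℝ x (v : H) : ℝ)‖ₑ ^ (-(1 / 2) : ℝ)) fun _ => hmeas.aemeasurable)
      (fun i => hmeas.comp (measurable_pi_apply i))]
    calc _ ≤ ∏ _i : Fin N, M' := by
          refine Finset.prod_le_prod' fun i _ => ?_
          rw [(measurePreserving_eval (fun _ : Fin N => μ) i).lintegral_comp hmeas,
            lintegral_add_left (by fun_prop), hM']
          gcongr
          exact hsb v hv
      _ = M' ^ N := by simp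
  refine (setLIntegral_mono' (measurableSet_annulus V) hbound).trans_lt ?_
  rw [setLIntegral_const]
  exact ENNReal.mul_lt_top (ENNReal.pow_lt_top hM't.lt_top) (volume_annulus_ne_top V).lt_top

end InverseMoment

end

end HybridReg

namespace HybridReg

noncomputable section

/-! ### Bounded inverse second moments of the leading empirical eigenvalues. -/

section EigenvalueMoment

open scoped ENNReal NNReal

variable {H : Type*} [NormedAddCommGroup H] [InnerProductSpace ℝ H] {n N : ℕ}

/-- Jensen for `t ↦ t⁻²`. Averaging over blocks keeps the moment bound independent of the sample
size. -/
theorem inv_sq_mean_le {m : ℕ} (q : Fin m → ℝ) (hm : 0 < m) (hq : ∀ b, 0 < q b) :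
    (((m : ℝ)⁻¹ * ∑ b, q b)⁻¹) ^ 2 ≤ (m : ℝ)⁻¹ * ∑ b, ((q b)⁻¹) ^ 2 := by
  have hm' : (0 : ℝ) < m := by exact_mod_cast hm
  have h := (convexOn_zpow (-2 : ℤ)).map_sum_le (t := Finset.univ) (w := fun _ : Fin m => (m : ℝ)⁻¹)
    (p := q) (fun _ _ => by positivity) (by simp [hm'.ne']) (fun b _ => hq b)
  simp only [smul_eq_mul, ← Finset.mul_sum] at h
  have e (t : ℝ) : t ^ (-2 : ℤ) = (t⁻¹) ^ 2 := by
    rw [zpow_neg, inv_pow]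
    rfl
  simpa only [e] using h

/-- The `b`-th block of length `N` of `{0, ..., n - 1}`. -/
def blockIdx (n N : ℕ) (b : Fin (n / N)) (i : Fin N) : Fin n :=
  ⟨b.val * N + i.val, by
    have h1 : (b.val + 1) * N ≤ n / N * N := Nat.mul_le_mul_right N b.2
    have h2 := Nat.div_mul_le_self n N
    have := i.2
    rw [add_mul, one_mul] at h1
    omega⟩

theorem blockIdx_injective (n N : ℕ) :
    Function.Injective fun p : Fin (n / N) × Fin N => blockIdx n N p.1 p.2 := by
  rintro ⟨b, i⟩ ⟨b', i'⟩ h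
  have h1 : b.val * N + i.val = b'.val * N + i'.val := congrArg Fin.val h
  have hi := i.2
  have hi' := i'.2
  have hb : b.val = b'.val := by
    have e1 : (b.val * N + i.val) / N = b.val := by
      rw [mul_comm, Nat.mul_add_div (by omega), Nat.div_eq_of_lt hi, add_zero]
    have e2 : (b'.val * N + i'.val) / N = b'.val := by
      rw [mul_comm, Nat.mul_add_div (by omega), Nat.div_eq_of_lt hi', add_zero]
    rw [← e1, ← e2, h1]
  rw [hb] at h1
  exact Prod.ext (Fin.ext hb) (Fin.ext (by simpa using h1))

theorem sum_sampleForm_block_le (x : Fin n → H) (v : H) (N : ℕ) :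
    ∑ b, sampleForm (fun i => x (blockIdx n N b i)) v ≤ sampleForm x v := by
  simp only [sampleForm]
  rw [← Fintype.sum_prod_type' (f := fun b i => (inner ℝ (x (blockIdx n N b i)) v : ℝ) ^ 2)]
  calc ∑ p : Fin (n / N) × Fin N, (inner ℝ (x (blockIdx n N p.1 p.2)) v : ℝ) ^ 2
      = ∑ k ∈ Finset.univ.map ⟨_, blockIdx_injective n N⟩, (inner ℝ (x k) v : ℝ) ^ 2 := by
        rw [Finset.sum_map]
        rfl
    _ ≤ _ := Finset.sum_le_sum_of_subset_of_nonneg (Finset.subset_univ _)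
        fun _ _ _ => sq_nonneg _

variable [MeasurableSpace H] [BorelSpace H] (V : Submodule ℝ H) [FiniteDimensional ℝ V]

/-- A single minimising direction in `V` serves all blocks at once. The discarded remainder is
shorter than a block, so `n ≤ 2 * N * m` and the loss is a constant factor. -/
theorem IsSpectrum.inv_sq_le_sum_inverseBound {x : Fin n → H} {lam : Fin n → ℝ} {φ : Fin n → H}
    (h : IsSpectrum (empCov x) lam φ) (j : Fin n) (hj : j.val < Module.finrank ℝ V)
    (hN : 0 < N) (hNn : N ≤ n) :
    ((ENNReal.ofReal (lam j))⁻¹) ^ 2 ≤ ENNReal.ofReal (4 * N ^ 2) *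
      (((n / N : ℕ) : ℝ≥0∞)⁻¹ * ∑ b, inverseBound V fun i => x (blockIdx n N b i)) := by
  obtain ⟨v, hv, hv1, hvl⟩ := h.exists_inner_le V j hj
  set m := n / N with hm
  have hm0 : 0 < m := Nat.div_pos hNn hN
  have hmR : (0 : ℝ) < m := by exact_mod_cast hm0
  have hNR : (0 : ℝ) < N := by exact_mod_cast hN
  have hnR : (0 : ℝ) < n := by exact_mod_cast hN.trans_le hNn
  set q : Fin m → ℝ := fun b => sampleForm (fun i => x (blockIdx n N b i)) v with hq
  have hqG : ∀ b, ((ENNReal.ofReal (q b))⁻¹) ^ 2 ≤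
      inverseBound V fun i => x (blockIdx n N b i) := fun b => inv_sq_le_inverseBound V _ hv hv1
  refine le_trans ?_ (mul_le_mul_right (mul_le_mul_right
    (Finset.sum_le_sum fun b _ => hqG b) _) _)
  by_cases hpos : ∀ b, 0 < q b
  · have hsum : 0 < ∑ b, q b := by
      have : Nonempty (Fin m) := ⟨⟨0, hm0⟩⟩
      exact Finset.sum_pos (fun b _ => hpos b) Finset.univ_nonempty
    have hnm : (n : ℝ) ≤ 2 * N * m := by
      have h1 := Nat.lt_div_mul_add hN (a := n)
      have h2 : N ≤ n / N * N := Nat.le_mul_of_pos_left N hm0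
      have h3 : n ≤ 2 * N * m := by
        have : 2 * N * m = n / N * N + n / N * N := by rw [hm]; ring
        omega
      exact_mod_cast h3
    have hlam : (2 * (N : ℝ))⁻¹ * ((m : ℝ)⁻¹ * ∑ b, q b) ≤ lam j := by
      refine le_trans ?_ hvl
      rw [inner_empCov]
      change _ ≤ (n : ℝ)⁻¹ * sampleForm x v
      have h1 : ∑ b, q b ≤ sampleForm x v := sum_sampleForm_block_le x v N
      rw [← mul_assoc, ← mul_inv]
      exact mul_le_mul (inv_anti₀ hnR hnm) h1 hsum.le (by positivity)
    have hA : 0 < (m : ℝ)⁻¹ * ∑ b, q b := by positivity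
    have hlam0 : 0 < lam j := lt_of_lt_of_le (by positivity) hlam
    have h1 : ((lam j)⁻¹) ^ 2 ≤ 4 * N ^ 2 * ((m : ℝ)⁻¹ * ∑ b, ((q b)⁻¹) ^ 2) := by
      have h2 : (lam j)⁻¹ ≤ 2 * N * ((m : ℝ)⁻¹ * ∑ b, q b)⁻¹ := by
        have := inv_anti₀ (by positivity) hlam
        rwa [mul_inv, inv_inv] at this
      calc ((lam j)⁻¹) ^ 2 ≤ (2 * N * ((m : ℝ)⁻¹ * ∑ b, q b)⁻¹) ^ 2 := by gcongr
        _ = 4 * N ^ 2 * (((m : ℝ)⁻¹ * ∑ b, q b)⁻¹) ^ 2 := by ring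
        _ ≤ _ := by gcongr; exact inv_sq_mean_le q hm0 hpos
    have hconv : ∀ t : ℝ, 0 < t → ((ENNReal.ofReal t)⁻¹) ^ 2 = ENNReal.ofReal ((t⁻¹) ^ 2) := by
      intro t ht
      rw [← ENNReal.ofReal_inv_of_pos ht, ENNReal.ofReal_pow (by positivity)]
    rw [hconv _ hlam0]
    refine (ENNReal.ofReal_le_ofReal h1).trans (le_of_eq ?_)
    rw [ENNReal.ofReal_mul (by positivity), ENNReal.ofReal_mul (by positivity : (0 : ℝ) ≤ (m : ℝ)⁻¹),
      ENNReal.ofReal_inv_of_pos hmR, ENNReal.ofReal_natCast,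
      ENNReal.ofReal_sum_of_nonneg fun _ _ => by positivity]
    simp_rw [hconv _ (hpos _)]
    rfl
  -- If the form vanishes on some block, the right-hand side is infinite.
  · push Not at hpos
    obtain ⟨b, hb⟩ := hpos
    have htop : ∑ b, ((ENNReal.ofReal (q b))⁻¹) ^ 2 = ∞ := by
      rw [ENNReal.sum_eq_top]
      refine ⟨b, Finset.mem_univ b, ?_⟩
      simp [ENNReal.ofReal_of_nonpos hb]
    rw [htop, ENNReal.mul_top (by simp), ENNReal.mul_top (by positivity)]
    exact le_top

theorem measurePreserving_comp_of_injective {E : Type*} [MeasurableSpace E] (μ : Measure E)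
    [IsProbabilityMeasure μ] {ι κ : Type*} [Fintype ι] [Fintype κ] {f : κ → ι}
    (hf : Function.Injective f) :
    MeasurePreserving (fun (x : ι → E) (i : κ) => x (f i)) (Measure.pi fun _ => μ)
      (Measure.pi fun _ => μ) := by
  refine ⟨by fun_prop, ?_⟩
  have h := iIndepFun_pi (μ := fun _ : ι => μ) (X := fun _ (x : E) => x) fun _ => aemeasurable_id
  have h2 := (h.precomp hf).map_fun_eq_pi_map fun i => (measurable_pi_apply (f i)).aemeasurable
  rw [h2]
  congr 1
  funext i
  exact (measurePreserving_eval (fun _ : ι => μ) (f i)).map_eq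

/-- The negative moments of the leading empirical eigenvalues are bounded. -/
theorem lintegral_inv_sq_eigenvalue_le [SecondCountableTopology H] (μ : Measure H)
    [IsProbabilityMeasure μ] {lam : (Fin n → H) → Fin n → ℝ} {φ : (Fin n → H) → Fin n → H}
    (h : ∀ x, IsSpectrum (empCov x) (lam x) (φ x)) (j : Fin n)
    (hj : j.val < Module.finrank ℝ V) (hN : 0 < N) (hNn : N ≤ n) :
    ∫⁻ x, ((ENNReal.ofReal (lam x j))⁻¹) ^ 2 ∂(Measure.pi fun _ => μ) ≤
      ENNReal.ofReal (4 * N ^ 2) *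
        ∫⁻ x, inverseBound V x ∂(Measure.pi fun _ : Fin N => μ) := by
  refine (lintegral_mono fun x => (h x).inv_sq_le_sum_inverseBound V j hj hN hNn).trans ?_
  have hinj : ∀ b, Function.Injective (blockIdx n N b) := fun b i i' hii =>
    (Prod.ext_iff.1 (blockIdx_injective n N (a₁ := (b, i)) (a₂ := (b, i')) hii)).2
  have hmeas : ∀ b, Measurable fun x : Fin n → H =>
      inverseBound V fun i => x (blockIdx n N b i) := fun b =>
    (measurable_inverseBound V).comp (measurePreserving_comp_of_injective μ (hinj b)).measurable
  have hm0 : n / N ≠ 0 := (Nat.div_pos hNn hN).ne'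
  rw [lintegral_const_mul _ ((Finset.measurable_fun_sum _ fun b _ => hmeas b).const_mul _),
    lintegral_const_mul _ (Finset.measurable_fun_sum _ fun b _ => hmeas b),
    lintegral_finsetSum _ fun b _ => hmeas b]
  have hb : ∀ b, ∫⁻ x, (inverseBound V fun i => x (blockIdx n N b i)) ∂(Measure.pi fun _ => μ) =
      ∫⁻ x, inverseBound V x ∂(Measure.pi fun _ : Fin N => μ) := fun b =>
    (measurePreserving_comp_of_injective μ (hinj b)).lintegral_comp (measurable_inverseBound V)
  simp_rw [hb]
  rw [Finset.sum_const, Finset.card_univ, Fintype.card_fin, nsmul_eq_mul, ← mul_assoc (_⁻¹),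
    ENNReal.inv_mul_cancel (by exact_mod_cast hm0) (ENNReal.natCast_ne_top _), one_mul]

end EigenvalueMoment

/-! ### Second moment of a weighted noise sum. -/

section NoiseMoments

open scoped ENNReal NNReal

theorem lintegral_sum_mul_sq {n : ℕ} (ν : Measure ℝ) [IsProbabilityMeasure ν] (hν : MemLp id 2 ν)
    (hν0 : ∫ t, t ∂ν = 0) (h : Fin n → ℝ) :
    ∫⁻ e, ENNReal.ofReal ((∑ i, e i * h i) ^ 2) ∂(Measure.pi fun _ : Fin n => ν) =
      ENNReal.ofReal (Var[id; ν] * ∑ i, h i ^ 2) := by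
  have hL : ∀ i, MemLp (fun t : ℝ => t * h i) 2 ν := fun i => hν.mul_const (h i)
  have hmem : MemLp (fun e : Fin n → ℝ => ∑ i, e i * h i) 2 (Measure.pi fun _ : Fin n => ν) :=
    memLp_finsetSum _ fun i _ =>
      (hL i).comp_measurePreserving (measurePreserving_eval (fun _ : Fin n => ν) i)
  have hvar := variance_sum_pi hL
  have e1 : (∑ i, fun e : Fin n → ℝ => e i * h i) = fun e : Fin n → ℝ => ∑ i, e i * h i := by
    funext e
    simp
  rw [e1] at hvar
  have hmean : ∫ e, ∑ i, e i * h i ∂(Measure.pi fun _ : Fin n => ν) = 0 := by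
    rw [integral_finsetSum]
    · refine Finset.sum_eq_zero fun i _ => ?_
      rw [integral_mul_const]
      have := integral_comp_eval (μ := fun _ : Fin n => ν) (i := i) (f := fun t : ℝ => t)
        aestronglyMeasurable_id
      rw [this, hν0, zero_mul]
    · intro i _
      exact ((hL i).comp_measurePreserving
        (measurePreserving_eval (fun _ : Fin n => ν) i)).integrable (by norm_num)
  rw [variance_of_integral_eq_zero hmem.aemeasurable hmean] at hvar
  rw [← ofReal_integral_eq_lintegral_ofReal hmem.integrable_sq
    (Eventually.of_forall fun _ => sq_nonneg _)]
  congr 1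
  refine hvar.trans ?_
  rw [Finset.mul_sum]
  refine Finset.sum_congr rfl fun i _ => ?_
  rw [variance_mul_const]
  rfl

end NoiseMoments

/-! ### Gaussian inputs: norm moments, the sample mean, small balls. -/

section GaussianMoments

open scoped ENNReal NNReal

variable {H : Type*} [NormedAddCommGroup H] [InnerProductSpace ℝ H] [CompleteSpace H]
  [SecondCountableTopology H] [MeasurableSpace H] [BorelSpace H] (μ : Measure H) [IsGaussian μ]

theorem lintegral_one_add_enorm_sq_pow_ne_top (k : ℕ) :
    ∫⁻ x, (1 + ‖x‖ₑ ^ 2) ^ k ∂μ ≠ ∞ := by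
  have hbound : ∀ x : H, (1 + ‖x‖ₑ ^ 2) ^ k ≤ 2 ^ k * (1 + ‖x‖ₑ ^ (2 * k)) := by
    intro x
    rcases le_total 1 (‖x‖ₑ ^ 2) with h | h
    · calc (1 + ‖x‖ₑ ^ 2) ^ k ≤ (2 * ‖x‖ₑ ^ 2) ^ k := by rw [two_mul]; gcongr
        _ = 2 ^ k * ‖x‖ₑ ^ (2 * k) := by rw [mul_pow, pow_mul]
        _ ≤ _ := by gcongr; exact le_add_self
    · calc (1 + ‖x‖ₑ ^ 2) ^ k ≤ (1 + 1) ^ k := by gcongr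
        _ = 2 ^ k := by rw [one_add_one_eq_two]
        _ = 2 ^ k * 1 := (mul_one _).symm
        _ ≤ _ := by gcongr; exact le_self_add
  have hmom : ∫⁻ x, ‖x‖ₑ ^ (2 * k) ∂μ < ∞ := by
    rcases Nat.eq_zero_or_pos k with rfl | hk
    · simp
    · have h := (IsGaussian.memLp_id μ ((2 * k : ℕ) : ℝ≥0∞) (ENNReal.natCast_ne_top _)).2
      have h2 := lintegral_rpow_enorm_lt_top_of_eLpNorm_lt_top
        (by exact_mod_cast (by positivity : 2 * k ≠ 0)) (ENNReal.natCast_ne_top _) h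
      simpa [← ENNReal.rpow_natCast] using h2
  refine ((lintegral_mono hbound).trans_lt ?_).ne
  rw [lintegral_const_mul _ (by fun_prop), lintegral_add_left measurable_const]
  refine ENNReal.mul_lt_top (ENNReal.pow_lt_top ENNReal.ofNat_lt_top) ?_
  refine ENNReal.add_lt_top.2 ⟨by simp, hmom⟩

theorem inner_covarianceOperator_comm (z w : H) :
    inner ℝ (covarianceOperator μ z) w = inner ℝ z (covarianceOperator μ w) := by
  rw [covarianceOperator_inner IsGaussian.memLp_two_id, real_inner_comm,
    covarianceOperator_inner IsGaussian.memLp_two_id]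
  simp_rw [mul_comm]

variable {μ}

theorem map_inner_eq_gaussianReal (hμ : ∫ x, x ∂μ = 0) (v : H) :
    μ.map (fun x => (inner ℝ x v : ℝ)) =
      gaussianReal 0 (inner ℝ v (covarianceOperator μ v)).toNNReal := by
  have h : HasGaussianLaw (fun x : H => (inner ℝ x v : ℝ)) μ := by
    have := IsGaussian.hasGaussianLaw_id (μ := μ) |>.map_fun (innerSL ℝ v)
    simpa [real_inner_comm] using this
  have hmean : ∫ x, (inner ℝ x v : ℝ) ∂μ = 0 := by
    have : ∀ x : H, (inner ℝ x v : ℝ) = inner ℝ v x := fun x => real_inner_comm _ _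
    simp_rw [this]
    have := integral_inner (𝕜 := ℝ) (IsGaussian.integrable_id (μ := μ)) v
    simp only [id] at this
    rw [this, hμ, inner_zero_right]
  rw [h.map_eq_gaussianReal, hmean, variance_of_integral_eq_zero h.aemeasurable hmean,
    real_inner_comm, covarianceOperator_inner IsGaussian.memLp_two_id]
  simp only [real_inner_comm v, pow_two]

/-- The sum of the `⟪X i, β⟫` is Gaussian with variance `n * v`, hence distributed as `√n` times one
of them; `n⁻⁴ * n²` gives the rate. -/
theorem exists_lintegral_sampleMean_pow_four_le (hμ : ∫ x, x ∂μ = 0) (β : H) :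
    ∃ B : ℝ, 0 ≤ B ∧ ∀ n : ℕ, 0 < n → ∫⁻ x : Fin n → H,
      ENNReal.ofReal ((inner ℝ (sampleMean x) β : ℝ) ^ 4) ∂(Measure.pi fun _ => μ) ≤
        ENNReal.ofReal (B * ((n : ℝ)⁻¹) ^ 2) := by
  set v := (inner ℝ β (covarianceOperator μ β)).toNNReal with hv
  refine ⟨∫ t, t ^ 4 ∂(gaussianReal 0 v), by positivity, fun n hn => ?_⟩
  have hnR : (0 : ℝ) < n := by exact_mod_cast hn
  have hlaw : HasGaussianLaw (fun x : H => (inner ℝ x β : ℝ)) μ := by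
    have := IsGaussian.hasGaussianLaw_id (μ := μ) |>.map_fun (innerSL ℝ β)
    simpa [real_inner_comm] using this
  have hind : iIndepFun (fun (i : Fin n) (x : Fin n → H) => (inner ℝ (x i) β : ℝ))
      (Measure.pi fun _ => μ) :=
    iIndepFun_pi (X := fun _ (x : H) => (inner ℝ x β : ℝ)) fun _ => hlaw.aemeasurable
  have hmapi : ∀ i : Fin n, (Measure.pi fun _ : Fin n => μ).map
      (fun x => (inner ℝ (x i) β : ℝ)) = gaussianReal 0 v := by
    intro i
    have h1 := Measure.map_map (μ := Measure.pi fun _ : Fin n => μ)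
      (g := fun x : H => (inner ℝ x β : ℝ)) (f := Function.eval i) (by fun_prop) (by fun_prop)
    rw [(measurePreserving_eval (fun _ : Fin n => μ) i).map_eq,
      map_inner_eq_gaussianReal hμ β] at h1
    exact h1.symm
  have hgi : ∀ i : Fin n, HasGaussianLaw (fun x : Fin n → H => (inner ℝ (x i) β : ℝ))
      (Measure.pi fun _ => μ) := fun i => ⟨by rw [hmapi i]; infer_instance⟩
  have hsum := (hind.hasGaussianLaw_fun_sum hgi).map_eq_gaussianReal
  have hmean : ∫ x : Fin n → H, ∑ i, (inner ℝ (x i) β : ℝ) ∂(Measure.pi fun _ => μ) = 0 := by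
    rw [integral_finsetSum _ fun i _ => (hgi i).integrable]
    refine Finset.sum_eq_zero fun i _ => ?_
    have := integral_map (hgi i).aemeasurable (f := fun t : ℝ => t) aestronglyMeasurable_id
    rw [← this, hmapi, integral_id_gaussianReal]
  have hvar : Var[fun x : Fin n → H => ∑ i, (inner ℝ (x i) β : ℝ); Measure.pi fun _ => μ] =
      n * v := by
    have h1 := variance_sum_pi (μ := fun _ : Fin n => μ)
      (X := fun _ (x : H) => (inner ℝ x β : ℝ)) fun _ => hlaw.memLp_two
    have e1 : (∑ i, fun x : Fin n → H => (inner ℝ (x i) β : ℝ)) =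
        fun x : Fin n → H => ∑ i, (inner ℝ (x i) β : ℝ) := by
      funext x
      simp
    rw [e1] at h1
    rw [h1]
    have h2 : Var[fun x : H => (inner ℝ x β : ℝ); μ] = v := by
      have := variance_map (X := fun t : ℝ => t) (Y := fun x : H => (inner ℝ x β : ℝ)) (μ := μ)
        aemeasurable_id hlaw.aemeasurable
      rw [map_inner_eq_gaussianReal hμ β, variance_fun_id_gaussianReal] at this
      exact this.symm
    simp [h2]
  rw [hmean, hvar] at hsum
  have hlawS : (Measure.pi fun _ : Fin n => μ).map (fun x => ∑ i, (inner ℝ (x i) β : ℝ)) =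
      (gaussianReal 0 v).map (√n * ·) := by
    rw [hsum, gaussianReal_map_const_mul]
    congr 1
    · simp
    · ext
      simp only [NNReal.coe_mul, NNReal.coe_mk, Real.sq_sqrt hnR.le]
      exact Real.coe_toNNReal _ (by positivity)
  have hmom : Integrable (fun t : ℝ => t ^ 4) (gaussianReal 0 v) := by
    have := (memLp_id_gaussianReal' (μ := 0) (v := v) ((4 : ℕ) : ℝ≥0∞)
      (ENNReal.natCast_ne_top _)).integrable_norm_pow (by norm_num)
    refine this.congr (Eventually.of_forall fun t => ?_)
    simp [Even.pow_abs (show Even 4 by decide)]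
  have e2 : ∀ x : Fin n → H, ENNReal.ofReal ((inner ℝ (sampleMean x) β : ℝ) ^ 4) =
      (fun t : ℝ => ENNReal.ofReal (((n : ℝ)⁻¹ * t) ^ 4)) (∑ i, (inner ℝ (x i) β : ℝ)) := by
    intro x
    simp only [sampleMean, real_inner_smul_left, sum_inner]
  simp_rw [e2]
  rw [← lintegral_map (f := fun t : ℝ => ENNReal.ofReal (((n : ℝ)⁻¹ * t) ^ 4)) (by fun_prop)
    (by fun_prop), hlawS, lintegral_map (by fun_prop) (by fun_prop)]
  have e3 : ∀ t : ℝ, ENNReal.ofReal (((n : ℝ)⁻¹ * (√n * t)) ^ 4) =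
      ENNReal.ofReal (((n : ℝ)⁻¹) ^ 2) * ENNReal.ofReal (t ^ 4) := by
    intro t
    rw [← ENNReal.ofReal_mul (by positivity)]
    congr 1
    have : √(n : ℝ) ^ 4 = n ^ 2 := by
      rw [show (4 : ℕ) = 2 * 2 from rfl, pow_mul, Real.sq_sqrt hnR.le]
    rw [mul_pow, mul_pow, this]
    field_simp
  simp_rw [e3]
  rw [lintegral_const_mul _ (by fun_prop), ← ofReal_integral_eq_lintegral_ofReal hmom
    (Eventually.of_forall fun t => by positivity), ← ENNReal.ofReal_mul (by positivity), mul_comm]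

/-- `V` is the span of `φ 0, ..., φ r`. On its annulus `‖v‖ ≥ 1/2`, so `⟪X, v⟫` has variance at
least `lam r / 4`, and the small-ball bound is uniform in `v`. -/
theorem exists_lintegral_inverseBound_lt_top (hμ : ∫ x, x ∂μ = 0) (φ : HilbertBasis ℕ ℝ H) {lam : ℕ → ℝ}
    (heigen : ∀ j, covarianceOperator μ (φ j) = lam j • φ j) (hlam0 : ∀ j, 0 < lam j)
    (hlam : Antitone lam) (r : ℕ) :
    ∃ (V : Submodule ℝ H) (_ : FiniteDimensional ℝ V) (N : ℕ), Module.finrank ℝ V = r + 1 ∧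
      0 < N ∧ ∫⁻ x, inverseBound V x ∂(Measure.pi fun _ : Fin N => μ) < ∞ := by
  let ψ : Fin (r + 1) → H := fun i => φ i
  have hψ : Orthonormal ℝ ψ := φ.orthonormal.comp _ Fin.val_injective
  let V : Submodule ℝ H := Submodule.span ℝ (Set.range ψ)
  have hV : Module.finrank ℝ V = r + 1 := by
    simpa using finrank_span_eq_card hψ.linearIndependent
  have hfin : FiniteDimensional ℝ V := FiniteDimensional.span_of_finite ℝ (Set.finite_range _)
  refine ⟨V, hfin, 8 * (Module.finrank ℝ V + 2), hV, by positivity, ?_⟩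
  obtain ⟨M, hM, hMb⟩ := exists_lintegral_enorm_rpow_gaussianReal_le
    (s := lam r / 4) (by have := hlam0 r; positivity)
  refine lintegral_inverseBound_lt_top V μ rfl (lintegral_one_add_enorm_sq_pow_ne_top μ _) hM
    fun v hv => ?_
  have hmeas : Measurable fun t : ℝ => ‖t‖ₑ ^ (-(1 / 2) : ℝ) := by fun_prop
  have h1 := lintegral_map (μ := μ) hmeas (g := fun x : H => (inner ℝ x (v : H) : ℝ))
    (by fun_prop)
  rw [← h1, map_inner_eq_gaussianReal hμ]
  refine hMb _ ?_
  refine le_trans ?_ (Real.le_coe_toNNReal _)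
  have hK : ∀ w k, inner ℝ (φ k) (covarianceOperator μ w) = lam k * inner ℝ (φ k) w := by
    intro w k
    rw [← inner_covarianceOperator_comm, heigen, real_inner_smul_left]
  refine le_trans ?_ (inner_apply_ge_of_eigen φ hK hlam r ?_)
  · have h2 : (1 / 2 : ℝ) ^ 2 ≤ ‖(v : H)‖ ^ 2 := by
      gcongr
      exact hv.1
    nlinarith [hlam0 r]
  · intro i hi
    have hle : V ≤ (ℝ ∙ (φ i))ᗮ := by
      rw [Submodule.span_le]
      rintro _ ⟨k, rfl⟩
      rw [SetLike.mem_coe, Submodule.mem_orthogonal_singleton_iff_inner_right]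
      refine φ.orthonormal.2 fun hik => ?_
      have := k.2
      omega
    exact Submodule.mem_orthogonal_singleton_iff_inner_right.1 (hle v.2)

end GaussianMoments

end

end HybridReg

namespace HybridReg

noncomputable section

/-! ### Mean square error of the unpenalised leading coefficients. -/

section CoefficientError

open scoped ENNReal NNReal

variable {H : Type*} [NormedAddCommGroup H] [InnerProductSpace ℝ H]
  [SecondCountableTopology H] [MeasurableSpace H] [BorelSpace H] {n : ℕ}

theorem measurable_sampleMean : Measurable (sampleMean : (Fin n → H) → H) := by
  unfold sampleMean
  fun_prop

/-- An eigenvalue is the Rayleigh quotient of its eigenvector, so measurability of the eigenvectors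
suffices. -/
theorem measurable_eigenvalue {lam : (Fin n → H) → Fin n → ℝ} {φ : (Fin n → H) → Fin n → H}
    (h : ∀ x, IsSpectrum (empCov x) (lam x) (φ x)) (hφ : ∀ j, Measurable fun x => φ x j)
    (j : Fin n) : Measurable fun x => lam x j := by
  have e : (fun x => lam x j) = fun x => (n : ℝ)⁻¹ * ∑ i, (inner ℝ (x i) (φ x j) : ℝ) ^ 2 :=
    funext fun x => ((h x).sum_inner_sq j).symm
  have := hφ j
  rw [e]
  fun_prop

/-- The error of the `j`-th least squares coefficient along the empirical eigenvectors. -/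
def coefficientError (a : ℝ) (β : H) (lam : (Fin n → H) → Fin n → ℝ)
    (φ : (Fin n → H) → Fin n → H) (j : Fin n) (p : (Fin n → H) × (Fin n → ℝ)) : ℝ :=
  (lam p.1 j)⁻¹ *
    inner ℝ (φ p.1 j) (empCrossCov p.1 fun i => a + inner ℝ (p.1 i) β + p.2 i) -
      inner ℝ (φ p.1 j) β

/-- Integrating first over the noise with the covariates fixed leaves a variance times `(n *
λ̂_j)⁻¹`; the rest depends on the covariates only. -/
theorem lintegral_coefficientError_le {μ : Measure H} [IsProbabilityMeasure μ] {ν : Measure ℝ}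
    [IsProbabilityMeasure ν] (hν : MemLp id 2 ν) (hν0 : ∫ t, t ∂ν = 0) (a : ℝ) (β : H)
    {lam : (Fin n → H) → Fin n → ℝ} {φ : (Fin n → H) → Fin n → H}
    (h : ∀ x, IsSpectrum (empCov x) (lam x) (φ x)) (hφ : ∀ j, Measurable fun x => φ x j)
    (j : Fin n) {B : ℝ} (hB : ∫⁻ x : Fin n → H,
      ENNReal.ofReal ((inner ℝ (sampleMean x) β : ℝ) ^ 4) ∂(Measure.pi fun _ => μ) ≤
        ENNReal.ofReal (B * ((n : ℝ)⁻¹) ^ 2)) {L : ℝ≥0∞}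
    (hL : ∫⁻ x, ((ENNReal.ofReal (lam x j))⁻¹) ^ 2 ∂(Measure.pi fun _ => μ) ≤ L) :
    ∫⁻ p, ENNReal.ofReal (coefficientError a β lam φ j p ^ 2)
      ∂((Measure.pi fun _ => μ).prod (Measure.pi fun _ => ν)) ≤
      ENNReal.ofReal ((n : ℝ)⁻¹) *
        (ENNReal.ofReal B + L + 2 * ENNReal.ofReal Var[id; ν] * (1 + L)) := by
  have hn : (0 : ℝ) < n := by exact_mod_cast j.pos
  have hlam := measurable_eigenvalue h hφ j
  have hmean : Measurable fun x : Fin n → H => sampleMean x := measurable_sampleMean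
  set A : (Fin n → H) → ℝ≥0∞ := fun x =>
    ENNReal.ofReal n * ENNReal.ofReal ((inner ℝ (sampleMean x) β : ℝ) ^ 4) with hA
  set D : (Fin n → H) → ℝ≥0∞ := fun x => ((ENNReal.ofReal (lam x j))⁻¹) ^ 2 with hD
  set W : (Fin n → H) → Fin n → ℝ := fun x i => noiseWeight (lam x) (φ x) x j i with hW
  have hAm : Measurable A := by
    simp only [hA]
    fun_prop
  have hDm : Measurable D := by
    simp only [hD]
    fun_prop
  have hpt : ∀ p : (Fin n → H) × (Fin n → ℝ), ENNReal.ofReal (coefficientError a β lam φ j p ^ 2) ≤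
      A p.1 + ENNReal.ofReal ((n : ℝ)⁻¹) * D p.1 +
        2 * ENNReal.ofReal ((∑ i, p.2 i * W p.1 i) ^ 2) := by
    intro p
    -- A zero eigenvalue makes the bound infinite, so it holds everywhere and not merely almost
    -- everywhere.
    rcases ((h p.1).nonneg j).eq_or_lt with h0 | h0
    · have : D p.1 = ∞ := by simp [hD, ← h0]
      rw [this, ENNReal.mul_top (by simpa using j.pos.ne')]
      simp
    · refine (ENNReal.ofReal_le_ofReal ((h p.1).coefficient_error_sq_le a β p.2 j h0)).trans
        (le_of_eq ?_)
      rw [ENNReal.ofReal_add (by positivity) (by positivity),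
        ENNReal.ofReal_add (by positivity) (by positivity), ENNReal.ofReal_mul (by positivity),
        ENNReal.ofReal_mul (by positivity), ENNReal.ofReal_mul (by positivity),
        ENNReal.ofReal_pow (by positivity : 0 ≤ (lam p.1 j)⁻¹), ENNReal.ofReal_inv_of_pos h0]
      simp [hA, hD, hW]
  have hinner : ∀ x : Fin n → H, ∫⁻ e : Fin n → ℝ, (A x + ENNReal.ofReal ((n : ℝ)⁻¹) * D x +
      2 * ENNReal.ofReal ((∑ i, e i * W x i) ^ 2)) ∂(Measure.pi fun _ => ν) ≤
      A x + ENNReal.ofReal ((n : ℝ)⁻¹) * D x +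
        2 * (ENNReal.ofReal Var[id; ν] * ENNReal.ofReal ((n : ℝ)⁻¹)) * (1 + D x) := by
    intro x
    rw [lintegral_add_left measurable_const, lintegral_const, measure_univ, mul_one,
      lintegral_const_mul _ (by fun_prop), lintegral_sum_mul_sq ν hν hν0, mul_assoc 2]
    gcongr
    rw [ENNReal.ofReal_mul (variance_nonneg _ _), mul_assoc]
    gcongr
    refine (ENNReal.ofReal_le_ofReal ((h x).sum_noiseWeight_sq_le j)).trans ?_
    rw [ENNReal.ofReal_mul (by positivity)]
    gcongr
    rcases ((h x).nonneg j).eq_or_lt with h0 | h0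
    · simp [← h0]
    · rw [ENNReal.ofReal_inv_of_pos h0]
      -- `t ≤ 1 + t²`: the first inverse moment is controlled by the second.
      rcases le_total (ENNReal.ofReal (lam x j))⁻¹ 1 with h1 | h1
      · exact h1.trans le_self_add
      · calc (ENNReal.ofReal (lam x j))⁻¹ ≤ D x := by
              simp only [hD]
              exact le_self_pow₀ h1 two_ne_zero
          _ ≤ _ := le_add_self
  calc ∫⁻ p, ENNReal.ofReal (coefficientError a β lam φ j p ^ 2)
        ∂((Measure.pi fun _ => μ).prod (Measure.pi fun _ => ν))
      ≤ ∫⁻ x, ∫⁻ e, ENNReal.ofReal (coefficientError a β lam φ j (x, e) ^ 2)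
          ∂(Measure.pi fun _ => ν) ∂(Measure.pi fun _ => μ) := lintegral_prod_le _
    _ ≤ ∫⁻ x, (A x + ENNReal.ofReal ((n : ℝ)⁻¹) * D x +
        2 * (ENNReal.ofReal Var[id; ν] * ENNReal.ofReal ((n : ℝ)⁻¹)) * (1 + D x))
          ∂(Measure.pi fun _ => μ) :=
        lintegral_mono fun x => (lintegral_mono fun e => hpt (x, e)).trans (hinner x)
    _ = ∫⁻ x, A x ∂(Measure.pi fun _ => μ) +
          ENNReal.ofReal ((n : ℝ)⁻¹) * ∫⁻ x, D x ∂(Measure.pi fun _ => μ) +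
          2 * (ENNReal.ofReal Var[id; ν] * ENNReal.ofReal ((n : ℝ)⁻¹)) *
            (1 + ∫⁻ x, D x ∂(Measure.pi fun _ => μ)) := by
        rw [lintegral_add_left (by fun_prop), lintegral_add_left hAm,
          lintegral_const_mul (ENNReal.ofReal ((n : ℝ)⁻¹)) hDm,
          lintegral_const_mul _ (hDm.const_add 1), lintegral_add_left measurable_const,
          lintegral_const, measure_univ, mul_one]
    _ ≤ ENNReal.ofReal ((n : ℝ)⁻¹) * ENNReal.ofReal B + ENNReal.ofReal ((n : ℝ)⁻¹) * L +
          2 * (ENNReal.ofReal Var[id; ν] * ENNReal.ofReal ((n : ℝ)⁻¹)) * (1 + L) := by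
        gcongr
        simp only [hA]
        rw [lintegral_const_mul _ (by fun_prop)]
        refine (mul_le_mul_right hB _).trans (le_of_eq ?_)
        rw [← ENNReal.ofReal_mul (by positivity), ← ENNReal.ofReal_mul (by positivity)]
        congr 1
        field_simp
    _ = _ := by ring

variable [CompleteSpace H]

/-- The error of the leading least squares coefficients is of order `n⁻¹` in mean square. -/
theorem exists_lintegral_coefficientError_le {μ : Measure H} [IsGaussian μ]
    (hμ : ∫ x, x ∂μ = 0) {ν : Measure ℝ} [IsProbabilityMeasure ν] (hν : MemLp id 2 ν)
    (hν0 : ∫ t, t ∂ν = 0) (φ : HilbertBasis ℕ ℝ H) {lam : ℕ → ℝ}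
    (heigen : ∀ j, covarianceOperator μ (φ j) = lam j • φ j) (hlam0 : ∀ j, 0 < lam j)
    (hlam : Antitone lam) (a : ℝ) (β : H) (r : ℕ)
    {lamhat : ∀ n : ℕ, (Fin n → H) → Fin n → ℝ} {φhat : ∀ n : ℕ, (Fin n → H) → Fin n → H}
    (hspec : ∀ (n : ℕ) (x : Fin n → H), IsSpectrum (empCov x) (lamhat n x) (φhat n x))
    (hmeas : ∀ (n : ℕ) (j : Fin n), Measurable fun x : Fin n → H => φhat n x j) :
    ∃ (C : ℝ) (N : ℕ), 0 ≤ C ∧ ∀ n ≥ N, ∀ j : Fin n, j.val < r →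
      (∀ᵐ x ∂(Measure.pi fun _ => μ), 0 < lamhat n x j) ∧
      ∫⁻ p, ENNReal.ofReal (coefficientError a β (lamhat n) (φhat n) j p ^ 2)
        ∂((Measure.pi fun _ => μ).prod (Measure.pi fun _ => ν)) ≤
          ENNReal.ofReal (C * (n : ℝ)⁻¹) := by
  obtain ⟨V, hfin, N, hV, hN, hGtop⟩ :=
    exists_lintegral_inverseBound_lt_top hμ φ heigen hlam0 hlam r
  obtain ⟨B, hB0, hB⟩ := exists_lintegral_sampleMean_pow_four_le hμ β
  set L := ENNReal.ofReal (4 * N ^ 2) *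
    ∫⁻ x, inverseBound V x ∂(Measure.pi fun _ : Fin N => μ) with hL
  have hLtop : L ≠ ∞ := ENNReal.mul_ne_top ENNReal.ofReal_ne_top hGtop.ne
  have hCtop : ENNReal.ofReal B + L + 2 * ENNReal.ofReal Var[id; ν] * (1 + L) ≠ ∞ := by
    finiteness
  refine ⟨(ENNReal.ofReal B + L + 2 * ENNReal.ofReal Var[id; ν] * (1 + L)).toReal, N,
    ENNReal.toReal_nonneg, fun n hn j hj => ?_⟩
  have hLj : ∫⁻ x, ((ENNReal.ofReal (lamhat n x j))⁻¹) ^ 2 ∂(Measure.pi fun _ => μ) ≤ L :=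
    lintegral_inv_sq_eigenvalue_le V μ (hspec n) j (by rw [hV]; omega) hN hn
  have hm := measurable_eigenvalue (hspec n) (hmeas n) j
  constructor
  -- The inverse of a zero eigenvalue is `∞` in `ℝ≥0∞`, so a finite inverse moment forces positivity
  -- almost everywhere.
  · have h1 := ae_lt_top (by fun_prop) (hLj.trans_lt hLtop.lt_top).ne
    filter_upwards [h1] with x hx
    by_contra hneg
    rw [ENNReal.ofReal_of_nonpos (not_lt.1 hneg)] at hx
    simp at hx
  · refine (lintegral_coefficientError_le hν hν0 a β (hspec n) (hmeas n) j (hB n j.pos)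
      hLj).trans (le_of_eq ?_)
    rw [ENNReal.ofReal_mul ENNReal.toReal_nonneg, ENNReal.ofReal_toReal hCtop, mul_comm]

end CoefficientError

/-! ### Convergence of the empirical covariance operator. -/

section LawOfLargeNumbers

variable {H : Type*} [NormedAddCommGroup H] [InnerProductSpace ℝ H] [CompleteSpace H]
  [SecondCountableTopology H] [MeasurableSpace H] [BorelSpace H]
  {Ω : Type*} [MeasurableSpace Ω] {P : Measure Ω}

theorem continuous_rankOne_self {H : Type*} [NormedAddCommGroup H] [InnerProductSpace ℝ H] :
    Continuous fun x : H => InnerProductSpace.rankOne ℝ x x :=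
  (InnerProductSpace.rankOne ℝ).continuous.clm_apply continuous_id

theorem continuous_empCov {H : Type*} [NormedAddCommGroup H] [InnerProductSpace ℝ H] {n : ℕ} :
    Continuous (empCov : (Fin n → H) → H →L[ℝ] H) := by
  have h := continuous_rankOne_self (H := H)
  unfold empCov
  exact (continuous_finsetSum _ fun i _ => h.comp (continuous_apply i)).const_smul (n : ℝ)⁻¹

/-- Strong law of large numbers for the empirical covariance operator, in operator norm. -/
theorem tendsto_empCov {X : ℕ → Ω → H} (hX : MemLp (X 0) 2 P) (hindep : iIndepFun X P)
    (hident : ∀ i, IdentDistrib (X i) (X 0) P P) :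
    ∀ᵐ ω ∂P, Tendsto (fun n : ℕ => empCov fun i : Fin n => X i ω) atTop
      (𝓝 (covarianceOperator (P.map (X 0)))) := by
  have hcont := continuous_rankOne_self (H := H)
  have hint : Integrable (fun ω => InnerProductSpace.rankOne ℝ (X 0 ω) (X 0 ω)) P := by
    refine (hX.integrable_norm_pow two_ne_zero).mono'
      (hcont.comp_aestronglyMeasurable hX.aestronglyMeasurable) (Eventually.of_forall fun ω => ?_)
    rw [InnerProductSpace.norm_rankOne, pow_two]
  -- The strong law in the Banach space of bounded operators; since `‖x ⊗ x‖ = ‖x‖²`, a second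
  -- moment of `X 0` gives integrability.
  have h := strong_law_ae (fun i ω => InnerProductSpace.rankOne ℝ (X i ω) (X i ω)) hint
    (fun i j hij => (hindep.indepFun hij).comp hcont.measurable hcont.measurable)
    (fun i => (hident i).comp hcont.measurable)
  have hmean : ∫ ω, InnerProductSpace.rankOne ℝ (X 0 ω) (X 0 ω) ∂P =
      covarianceOperator (P.map (X 0)) := by
    ext v
    rw [ContinuousLinearMap.integral_apply hint, covarianceOperator_apply, integral_map]
    · simp only [InnerProductSpace.rankOne_apply, real_inner_comm v]
    · exact hX.aestronglyMeasurable.aemeasurable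
    · fun_prop
    · rw [memLp_map_measure_iff aestronglyMeasurable_id hX.aestronglyMeasurable.aemeasurable]
      exact hX
  filter_upwards [h] with ω hω
  rw [hmean] at hω
  refine hω.congr fun n => ?_
  rw [empCov, Finset.sum_range]

end LawOfLargeNumbers

end

end HybridReg

namespace HybridReg

noncomputable section

/-! ### Integrated comparison of the losses on the product law. -/

section LossComparison

open scoped ENNReal

variable {H : Type*} [NormedAddCommGroup H] [InnerProductSpace ℝ H]
  [SecondCountableTopology H] [MeasurableSpace H] [BorelSpace H] {n : ℕ}

/-- The responses of the functional linear model, as a function of covariates and errors. -/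
def response (a : ℝ) (β : H) (p : (Fin n → H) × (Fin n → ℝ)) (i : Fin n) : ℝ :=
  a + inner ℝ (p.1 i) β + p.2 i

variable {a : ℝ} {β : H} {lam : (Fin n → H) → Fin n → ℝ} {φ : (Fin n → H) → Fin n → H}

theorem measurable_empCrossCov_response :
    Measurable fun p : (Fin n → H) × (Fin n → ℝ) => empCrossCov p.1 (response a β p) := by
  unfold empCrossCov sampleMean response
  fun_prop

theorem measurable_tikhonov_response (h : ∀ x, IsSpectrum (empCov x) (lam x) (φ x))
    (hφ : ∀ j, Measurable fun x => φ x j) {ρ : ℝ} (hρ : 0 < ρ) :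
    Measurable fun p : (Fin n → H) × (Fin n → ℝ) => tikhonov ρ p.1 (response a β p) := by
  have hl := measurable_eigenvalue h hφ
  have hC := measurable_empCrossCov_response (n := n) (a := a) (β := β)
  simp_rw [fun p : (Fin n → H) × (Fin n → ℝ) => tikhonov_eq (h p.1) hρ (response a β p),
    diagOp_apply]
  fun_prop

theorem measurable_coefficientError (h : ∀ x, IsSpectrum (empCov x) (lam x) (φ x))
    (hφ : ∀ j, Measurable fun x => φ x j) (j : Fin n) :
    Measurable (coefficientError a β lam φ j) := by
  have hl := measurable_eigenvalue h hφ
  have hC := measurable_empCrossCov_response (n := n) (a := a) (β := β)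
  unfold response at hC
  unfold coefficientError
  fun_prop

variable [CompleteSpace H] {μ : Measure H} [IsGaussian μ] {ν : Measure ℝ} [IsProbabilityMeasure ν]

theorem integrable_norm_tikhonov_sub_sq (hν : MemLp id 2 ν)
    (h : ∀ x, IsSpectrum (empCov x) (lam x) (φ x)) (hφ : ∀ j, Measurable fun x => φ x j)
    {ρ : ℝ} (hρ : 0 < ρ) :
    Integrable (fun p => ‖tikhonov ρ p.1 (response a β p) - β‖ ^ 2)
      ((Measure.pi fun _ : Fin n => μ).prod (Measure.pi fun _ : Fin n => ν)) := by
  set Q := (Measure.pi fun _ : Fin n => μ).prod (Measure.pi fun _ : Fin n => ν) with hQ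
  have hm := measurable_tikhonov_response (a := a) (β := β) h hφ hρ
  have hy : ∀ i, MemLp (fun p => response a β p i) 2 Q := by
    intro i
    have h1 : MemLp (fun p : (Fin n → H) × (Fin n → ℝ) => (inner ℝ (p.1 i) β : ℝ)) 2 Q := by
      have h2 : MemLp (fun x : H => (inner ℝ x β : ℝ)) 2 μ :=
        IsGaussian.memLp_two_id.inner_const β
      have h3 := h2.comp_measurePreserving (measurePreserving_eval (fun _ : Fin n => μ) i)
      exact h3.comp_measurePreserving measurePreserving_fst
    have h2 : MemLp (fun p : (Fin n → H) × (Fin n → ℝ) => p.2 i) 2 Q := by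
      have h3 := hν.comp_measurePreserving (measurePreserving_eval (fun _ : Fin n => ν) i)
      exact h3.comp_measurePreserving measurePreserving_snd
    exact ((memLp_const a).add h1).add h2
  have hbound : Integrable (fun p => 2 * (ρ⁻¹ * ∑ i, response a β p i ^ 2) + 2 * ‖β‖ ^ 2) Q :=
    (((integrable_finsetSum _ fun i _ => (hy i).integrable_sq).const_mul _).const_mul _).add
      (integrable_const _)
  refine hbound.mono' ((hm.sub_const β).norm.pow_const 2).aestronglyMeasurable (Eventually.of_forall fun p => ?_)
  rw [Real.norm_of_nonneg (sq_nonneg _)]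
  have h1 := norm_tikhonov_sq_le (h p.1) hρ (response a β p)
  have h2 := norm_sub_le (tikhonov ρ p.1 (response a β p)) β
  nlinarith [norm_nonneg (tikhonov ρ p.1 (response a β p) - β), norm_nonneg β,
    norm_nonneg (tikhonov ρ p.1 (response a β p)),
    sq_nonneg (‖tikhonov ρ p.1 (response a β p)‖ - ‖β‖)]

/-- Integrates `shrinkage_gain`. The bias is bounded below by `w` on `S` and by `0` off `S`, which
yields `w / 2`; each of the at most `r` variances costs `3 * τ`. -/
theorem integral_tikhonov_sub_integral_hybrid_ge (hν : MemLp id 2 ν)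
    (h : ∀ x, IsSpectrum (empCov x) (lam x) (φ x)) (hφ : ∀ j, Measurable fun x => φ x j)
    {ρ : ℝ} (hρ : 0 < ρ) {r : ℕ} {τ : ℝ} (hτ : 0 ≤ τ)
    (herr : ∀ j : Fin n, j.val < r → (∀ᵐ x ∂(Measure.pi fun _ => μ), 0 < lam x j) ∧
      ∫⁻ p, ENNReal.ofReal (coefficientError a β lam φ j p ^ 2)
        ∂((Measure.pi fun _ => μ).prod (Measure.pi fun _ => ν)) ≤ ENNReal.ofReal τ)
    {S : Set (Fin n → H)} (hS : MeasurableSet S)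
    (hSμ : 1 / 2 ≤ (Measure.pi fun _ => μ).real S) {w : ℝ} (hw : 0 ≤ w)
    (hwS : ∀ x ∈ S, w ≤ ∑ j : Fin n with j.val < r,
      1 / 2 * (ρ / (lam x j + ρ)) ^ 2 * (inner ℝ (φ x j) β : ℝ) ^ 2) :
    Integrable (fun p => ‖hybrid r ρ (φ p.1) p.1 (response a β p) - β‖ ^ 2)
      ((Measure.pi fun _ : Fin n => μ).prod (Measure.pi fun _ : Fin n => ν)) ∧
    w / 2 - 3 * r * τ ≤
      ∫ p, ‖tikhonov ρ p.1 (response a β p) - β‖ ^ 2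
        ∂((Measure.pi fun _ : Fin n => μ).prod (Measure.pi fun _ : Fin n => ν)) -
      ∫ p, ‖hybrid r ρ (φ p.1) p.1 (response a β p) - β‖ ^ 2
        ∂((Measure.pi fun _ : Fin n => μ).prod (Measure.pi fun _ : Fin n => ν)) := by
  set Q := (Measure.pi fun _ : Fin n => μ).prod (Measure.pi fun _ : Fin n => ν) with hQ
  have hl := measurable_eigenvalue h hφ
  have hC := measurable_empCrossCov_response (n := n) (a := a) (β := β)
  have hTR := integrable_norm_tikhonov_sub_sq (a := a) (β := β) (μ := μ) hν h hφ hρ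
  let s : Finset (Fin n) := Finset.univ.filter fun j => j.val < r
  let D : Fin n → (Fin n → H) × (Fin n → ℝ) → ℝ := fun j p =>
    ((lam p.1 j + ρ)⁻¹ * inner ℝ (φ p.1 j) (empCrossCov p.1 (response a β p)) -
      inner ℝ (φ p.1 j) β) ^ 2 - coefficientError a β lam φ j p ^ 2
  have hDm : ∀ j, Measurable (D j) := by
    intro j
    have := measurable_coefficientError (a := a) (β := β) h hφ j
    fun_prop
  have hdiff : ∀ p, ‖tikhonov ρ p.1 (response a β p) - β‖ ^ 2 -
      ‖hybrid r ρ (φ p.1) p.1 (response a β p) - β‖ ^ 2 = ∑ j ∈ s, D j p := fun p =>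
    norm_tikhonov_sub_sq_sub_norm_hybrid_sub_sq (h p.1) hρ r (response a β p) β
  have herrint : ∀ j ∈ s, Integrable (fun p => coefficientError a β lam φ j p ^ 2) Q := by
    intro j hj
    have hm := measurable_coefficientError (a := a) (β := β) h hφ j
    refine ⟨by fun_prop, ?_⟩
    rw [hasFiniteIntegral_iff_ofReal (Eventually.of_forall fun p => sq_nonneg _)]
    exact (herr j (Finset.mem_filter.1 hj).2).2.trans_lt ENNReal.ofReal_lt_top
  have herrle : ∀ j ∈ s, ∫ p, coefficientError a β lam φ j p ^ 2 ∂Q ≤ τ := by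
    intro j hj
    rw [integral_eq_lintegral_of_nonneg_ae (Eventually.of_forall fun p => sq_nonneg _)
      (herrint j hj).aestronglyMeasurable]
    exact ENNReal.toReal_le_of_le_ofReal hτ (herr j (Finset.mem_filter.1 hj).2).2
  have hpos : ∀ j ∈ s, ∀ᵐ p ∂Q, 0 < lam p.1 j := fun j hj =>
    measurePreserving_fst.quasiMeasurePreserving.ae (herr j (Finset.mem_filter.1 hj).2).1
  have hDint : ∀ j ∈ s, Integrable (D j) Q := by
    intro j hj
    have hb : Integrable (fun p => 2 * ‖β‖ ^ 2 + 3 * coefficientError a β lam φ j p ^ 2) Q :=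
      (integrable_const _).add ((herrint j hj).const_mul 3)
    refine hb.mono' (hDm j).aestronglyMeasurable ?_
    filter_upwards [hpos j hj] with p hp
    refine (abs_shrinkage_gain_le hp hρ _ _).trans ?_
    have h1 : (inner ℝ (φ p.1 j) β : ℝ) ^ 2 ≤ ‖β‖ ^ 2 := by
      simpa using sum_inner_sq_le (h p.1).orthonormal {j} β
    change 2 * _ + 3 * coefficientError a β lam φ j p ^ 2 ≤ _
    linarith
  have hsumint : Integrable (fun p => ∑ j ∈ s, D j p) Q := integrable_finsetSum _ hDint
  -- The hybrid loss inherits integrability from the Tikhonov loss and the finitely many difference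
  -- terms.
  have hHReq : (fun p => ‖hybrid r ρ (φ p.1) p.1 (response a β p) - β‖ ^ 2) =
      fun p => ‖tikhonov ρ p.1 (response a β p) - β‖ ^ 2 - ∑ j ∈ s, D j p := by
    funext p
    rw [← hdiff p]
    ring
  refine ⟨by rw [hHReq]; exact hTR.sub hsumint, ?_⟩
  rw [hHReq, integral_sub hTR hsumint, sub_sub_cancel]
  have hlow : ∀ᵐ p ∂Q, (Prod.fst ⁻¹' S).indicator (fun _ => w) p -
      3 * ∑ j ∈ s, coefficientError a β lam φ j p ^ 2 ≤ ∑ j ∈ s, D j p := by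
    have hall : ∀ᵐ p ∂Q, ∀ j ∈ s, 0 < lam p.1 j := by
      exact (ae_ball_iff s.countable_toSet).2 hpos
    filter_upwards [hall] with p hp
    have h1 : (Prod.fst ⁻¹' S).indicator (fun _ => w) p ≤
        ∑ j ∈ s, 1 / 2 * (ρ / (lam p.1 j + ρ)) ^ 2 * (inner ℝ (φ p.1 j) β : ℝ) ^ 2 := by
      by_cases hpS : p ∈ Prod.fst ⁻¹' S
      · rw [Set.indicator_of_mem hpS]
        exact hwS p.1 hpS
      · rw [Set.indicator_of_notMem hpS]
        exact Finset.sum_nonneg fun j _ => by positivity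
    rw [Finset.mul_sum]
    refine (sub_le_sub_right h1 _).trans ?_
    rw [← Finset.sum_sub_distrib]
    exact Finset.sum_le_sum fun j hj => shrinkage_gain (hp j hj) hρ _ _
  have hindint : Integrable ((Prod.fst ⁻¹' S).indicator fun _ => w) Q :=
    (integrable_const w).indicator (measurable_fst hS)
  have herrsum : Integrable (fun p => 3 * ∑ j ∈ s, coefficientError a β lam φ j p ^ 2) Q :=
    (integrable_finsetSum _ herrint).const_mul 3
  refine le_trans ?_ (integral_mono_ae (hindint.sub herrsum) hsumint hlow)
  have e1 : ∫ p, ((Prod.fst ⁻¹' S).indicator (fun _ => w) p -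
      3 * ∑ j ∈ s, coefficientError a β lam φ j p ^ 2) ∂Q =
      Q.real (Prod.fst ⁻¹' S) * w -
        3 * ∑ j ∈ s, ∫ p, coefficientError a β lam φ j p ^ 2 ∂Q := by
    rw [integral_sub hindint herrsum, integral_indicator_const _ (measurable_fst hS),
      integral_const_mul, integral_finsetSum _ herrint, smul_eq_mul]
  refine le_trans ?_ (le_of_eq e1.symm)
  have e2 : Q.real (Prod.fst ⁻¹' S) = (Measure.pi fun _ => μ).real S := by
    rw [measureReal_def, measureReal_def, (measurePreserving_fst (μ := Measure.pi fun _ : Fin n => μ)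
      (ν := Measure.pi fun _ : Fin n => ν)).measure_preimage hS.nullMeasurableSet]
  have h2 : ∑ j ∈ s, ∫ p, coefficientError a β lam φ j p ^ 2 ∂Q ≤ r * τ := by
    refine (Finset.sum_le_sum herrle).trans ?_
    rw [Finset.sum_const, nsmul_eq_mul]
    refine mul_le_mul_of_nonneg_right ?_ hτ
    have hcard : s.card ≤ (Finset.range r).card :=
      Finset.card_le_card_of_injOn Fin.val (fun j hj => by
        simpa using (Finset.mem_filter.1 hj).2) Fin.val_injective.injOn
    rw [Finset.card_range] at hcard
    exact_mod_cast hcard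
  rw [e2]
  nlinarith

end LossComparison

/-! ### The joint law of the sample. -/

section Sample

variable {H : Type*} [MeasurableSpace H]
  {Ω : Type*} [MeasurableSpace Ω] {P : Measure Ω} [IsProbabilityMeasure P]

/-- The joint law of the covariates and the errors of an i.i.d. sample. -/
theorem map_sample_eq_prod {X : ℕ → Ω → H} {e : ℕ → Ω → ℝ}
    (hindep : iIndepFun (fun i ω => (X i ω, e i ω)) P)
    (hident : ∀ i, IdentDistrib (fun ω => (X i ω, e i ω)) (fun ω => (X 0 ω, e 0 ω)) P P)
    (hXe : IndepFun (X 0) (e 0) P) (n : ℕ) :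
    P.map (fun ω => ((fun i : Fin n => X i ω), fun i : Fin n => e i ω)) =
      (Measure.pi fun _ : Fin n => P.map (X 0)).prod (Measure.pi fun _ : Fin n => P.map (e 0)) := by
  have hX0 : AEMeasurable (X 0) P := (hident 0).aemeasurable_fst.fst
  have he0 : AEMeasurable (e 0) P := (hident 0).aemeasurable_fst.snd
  have := Measure.isProbabilityMeasure_map hX0
  have := Measure.isProbabilityMeasure_map he0
  have hpair : ∀ i, P.map (fun ω => (X i ω, e i ω)) = (P.map (X 0)).prod (P.map (e 0)) := by
    intro i
    rw [(hident i).map_eq]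
    exact (indepFun_iff_map_prod_eq_prod_map_map hX0 he0).1 hXe
  have hn : iIndepFun (fun (i : Fin n) ω => (X i ω, e i ω)) P :=
    hindep.precomp Fin.val_injective
  have h1 := hn.map_fun_eq_pi_map fun i : Fin n => (hident i).aemeasurable_fst
  simp_rw [hpair] at h1
  have h2 := measurePreserving_arrowProdEquivProdArrow H ℝ (Fin n) (fun _ => P.map (X 0))
    (fun _ => P.map (e 0))
  rw [← h2.map_eq, ← h1, AEMeasurable.map_map_of_aemeasurable h2.measurable.aemeasurable
    (aemeasurable_pi_lambda _ fun i : Fin n => (hident i).aemeasurable_fst)]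
  rfl

end Sample

end

end HybridReg

namespace HybridReg

/-! ### Rates in `n` and the high-probability event. -/

section Asymptotics

open scoped ENNReal

theorem penalty_exponent_lt_half {α η ε : ℝ} (hα : 1 < α)
    (hregime : (η - 1 / 2 < α ∧ ε < α / (5 * α - 2 * η + 2)) ∨
      (α < η - 1 / 2 ∧ ε < α / (3 * α + 1))) : ε < 1 / 2 := by
  rcases hregime with ⟨h1, h2⟩ | ⟨_, h2⟩
  · refine h2.trans ?_
    rw [div_lt_iff₀ (by linarith)]
    linarith
  · refine h2.trans ?_
    rw [div_lt_iff₀ (by linarith)]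
    linarith

theorem eventually_inv_le_rpow {ε : ℝ} (hε : ε < 1 / 2) (A : ℝ) {κ : ℝ} (hκ : 0 < κ) :
    ∀ᶠ n : ℕ in atTop, A * (n : ℝ)⁻¹ ≤ κ * (n : ℝ) ^ (-2 * ε) := by
  have h1 : Tendsto (fun n : ℕ => |A| * (n : ℝ) ^ (-(1 - 2 * ε))) atTop (𝓝 (|A| * 0)) :=
    ((tendsto_rpow_neg_atTop (by linarith)).comp tendsto_natCast_atTop_atTop).const_mul _
  rw [mul_zero] at h1
  filter_upwards [h1.eventually_lt_const hκ, eventually_gt_atTop 0] with n hn hn0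
  have hnR : (0 : ℝ) < n := by exact_mod_cast hn0
  have h2 : (n : ℝ)⁻¹ = (n : ℝ) ^ (-(1 - 2 * ε)) * (n : ℝ) ^ (-2 * ε) := by
    rw [← Real.rpow_add hnR, ← Real.rpow_neg_one]
    congr 1
    ring
  rw [h2, ← mul_assoc]
  gcongr
  refine le_trans ?_ hn.le
  gcongr
  exact le_abs_self A

/-- The lower bound carries the rate of the bias; the upper bound keeps the denominators `λ̂_j + ρ`
bounded. -/
theorem eventually_penalty_bounds {c ε : ℝ} (hc : 0 < c) (hε : 0 < ε) {ρ : ℕ → ℝ}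
    (hρ : ρ ~[atTop] fun n : ℕ => c * (n : ℝ) ^ (-ε)) :
    ∀ᶠ n : ℕ in atTop, c / 2 * (n : ℝ) ^ (-ε) ≤ ρ n ∧ ρ n ≤ 2 * c := by
  filter_upwards [hρ.isLittleO.def (by norm_num : (0 : ℝ) < 1 / 2), eventually_ge_atTop 1]
    with n hn hn1
  have hnR : (1 : ℝ) ≤ n := by exact_mod_cast hn1
  have h0 : 0 ≤ (n : ℝ) ^ (-ε) := by positivity
  have h1 : (n : ℝ) ^ (-ε) ≤ 1 := Real.rpow_le_one_of_one_le_of_nonpos hnR (by linarith)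
  rw [Pi.sub_apply, Real.norm_eq_abs, Real.norm_of_nonneg (by positivity), abs_le] at hn
  constructor <;> nlinarith [hn.1, hn.2]

variable {H : Type*} [NormedAddCommGroup H] [InnerProductSpace ℝ H]

theorem IsSpectrum.eigenvalue_le_norm {n : ℕ} {K : H →L[ℝ] H} {lam : Fin n → ℝ} {φ : Fin n → H}
    (h : IsSpectrum K lam φ) (j : Fin n) : lam j ≤ ‖K‖ := by
  have h1 := h.inner_eq j (φ j)
  rw [real_inner_self_eq_norm_sq, h.orthonormal.1 j, one_pow, mul_one] at h1
  rw [← h1]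
  refine (real_inner_le_norm _ _).trans ?_
  have := K.le_opNorm (φ j)
  rw [h.orthonormal.1 j] at this ⊢
  simpa using this

/-- On the event that the empirical covariance operator is close to `K`, the Tikhonov estimator has
a shrinkage bias of order `ρ` in the leading components. -/
theorem exists_shrinkage_bias_ge {K : H →L[ℝ] H} (φ : HilbertBasis ℕ ℝ H) {lam : ℕ → ℝ}
    (hK : ∀ v k, inner ℝ (φ k) (K v) = lam k * inner ℝ (φ k) v)
    (hKφ : ∀ k, K (φ k) = lam k • φ k) (hlam : StrictAnti lam) {k r : ℕ} (hkr : k < r)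
    {β : H} (hk : inner ℝ β (φ k) ≠ 0) :
    ∃ τ : ℝ, 0 < τ ∧ ∀ {n : ℕ} {L : H →L[ℝ] H} {lamhat : Fin n → ℝ} {φhat : Fin n → H}
      {ρ R : ℝ}, IsSpectrum L lamhat φhat → r < n → ‖L - K‖ ≤ τ → 0 < ρ → ρ ≤ R →
      1 / 8 * (ρ / (‖K‖ + 1 + R)) ^ 2 * (inner ℝ β (φ k) : ℝ) ^ 2 ≤
        ∑ j : Fin n with j.val < r,
          1 / 2 * (ρ / (lamhat j + ρ)) ^ 2 * (inner ℝ (φhat j) β : ℝ) ^ 2 := by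
  have hδ : 0 < lam k - lam r := sub_pos.2 (hlam hkr)
  have hb : 0 < |(inner ℝ β (φ k) : ℝ)| := abs_pos.2 hk
  -- The `1` bounds the empirical eigenvalues by `‖K‖ + 1`; the other two entries are the smallness
  -- conditions of `IsSpectrum.sum_inner_sq_ge`, with `+ 1` keeping the denominator positive.
  refine ⟨min 1 (min ((lam k - lam r) / 4)
    ((lam k - lam r) * |(inner ℝ β (φ k) : ℝ)| / (4 * ‖β‖ + 1))), by positivity,
    fun {n L lamhat φhat ρ R} h hrn hL hρ hρR => ?_⟩
  rw [le_min_iff, le_min_iff, le_div_iff₀ (by positivity : 0 < 4 * ‖β‖ + 1)] at hL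
  obtain ⟨hL1, hL2, hL3⟩ := hL
  have hmain := h.sum_inner_sq_ge φ hK hKφ hlam hkr hrn β hL2 (by nlinarith [norm_nonneg (L - K)])
  calc 1 / 8 * (ρ / (‖K‖ + 1 + R)) ^ 2 * (inner ℝ β (φ k) : ℝ) ^ 2
      = 1 / 2 * (ρ / (‖K‖ + 1 + R)) ^ 2 * ((inner ℝ β (φ k) : ℝ) ^ 2 / 4) := by ring
    _ ≤ 1 / 2 * (ρ / (‖K‖ + 1 + R)) ^ 2 *
          ∑ j : Fin n with j.val < r, (inner ℝ (φhat j) β : ℝ) ^ 2 := by gcongr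
    _ = ∑ j : Fin n with j.val < r,
          1 / 2 * (ρ / (‖K‖ + 1 + R)) ^ 2 * (inner ℝ (φhat j) β : ℝ) ^ 2 := Finset.mul_sum _ _ _
    _ ≤ _ := by
        refine Finset.sum_le_sum fun j _ => ?_
        have h1 : lamhat j ≤ ‖K‖ + 1 := by
          have h2 := h.eigenvalue_le_norm j
          have h3 := norm_le_norm_add_norm_sub' L K
          linarith
        have h2 : 0 < lamhat j + ρ := add_pos_of_nonneg_of_pos (h.nonneg j) hρ
        have h3 : 0 < ‖K‖ + 1 + R := lt_of_lt_of_le h2 (add_le_add h1 hρR)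
        gcongr

variable [SecondCountableTopology H] [MeasurableSpace H] [BorelSpace H]

theorem measurableSet_norm_empCov_sub_le (K : H →L[ℝ] H) (n : ℕ) (τ : ℝ) :
    MeasurableSet {x : Fin n → H | ‖empCov x - K‖ ≤ τ} :=
  (isClosed_le ((continuous_empCov.sub continuous_const).norm) continuous_const).measurableSet

variable [CompleteSpace H]
  {Ω : Type*} [MeasurableSpace Ω] {P : Measure Ω} [IsProbabilityMeasure P]

/-- Almost sure convergence gives convergence in probability, which depends only on the law of the
first `n` covariates and so passes to the product measure. -/
theorem eventually_half_le_real_norm_empCov_sub_le {X : ℕ → Ω → H} (hX : MemLp (X 0) 2 P)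
    (hindep : iIndepFun X P) (hident : ∀ i, IdentDistrib (X i) (X 0) P P) {τ : ℝ} (hτ : 0 < τ) :
    ∀ᶠ n : ℕ in atTop, 1 / 2 ≤ (Measure.pi fun _ : Fin n => P.map (X 0)).real
      {x | ‖empCov x - covarianceOperator (P.map (X 0))‖ ≤ τ} := by
  set K := covarianceOperator (P.map (X 0)) with hK
  have := Measure.isProbabilityMeasure_map (hident 0).aemeasurable_fst
  have hΦ : ∀ n : ℕ, AEMeasurable (fun ω (i : Fin n) => X i ω) P := fun n =>
    aemeasurable_pi_lambda _ fun i => (hident i).aemeasurable_fst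
  have hm : ∀ n : ℕ, AEStronglyMeasurable (fun ω => empCov fun i : Fin n => X i ω) P := fun n =>
    continuous_empCov.comp_aestronglyMeasurable (hΦ n).aestronglyMeasurable
  have h1 := tendstoInMeasure_iff_norm.1
    (tendstoInMeasure_of_tendsto_ae hm (tendsto_empCov hX hindep hident)) τ hτ
  filter_upwards [h1.eventually_lt_const (by norm_num : (0 : ℝ≥0∞) < 2⁻¹)] with n hn
  have hS := measurableSet_norm_empCov_sub_le K n τ
  have hn' : iIndepFun (fun i : Fin n => X i) P := hindep.precomp Fin.val_injective
  have hlaw : P.map (fun ω (i : Fin n) => X i ω) = Measure.pi fun _ : Fin n => P.map (X 0) := by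
    rw [hn'.map_fun_eq_pi_map fun i : Fin n => (hident i).aemeasurable_fst]
    congr 1
    funext i
    exact (hident i).map_eq
  rw [← hlaw]
  have hprob := Measure.isProbabilityMeasure_map (hΦ n)
  have h2 := probReal_add_probReal_compl (μ := P.map (fun ω (i : Fin n) => X i ω)) hS
  have h3 : (P.map (fun ω (i : Fin n) => X i ω)).real
      {x : Fin n → H | ‖empCov x - K‖ ≤ τ}ᶜ ≤ 1 / 2 := by
    rw [measureReal_def, Measure.map_apply_of_aemeasurable (hΦ n) hS.compl]
    refine ENNReal.toReal_le_of_le_ofReal (by norm_num) ?_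
    have h4 : ENNReal.ofReal (1 / 2) = 2⁻¹ := by
      rw [one_div, ENNReal.ofReal_inv_of_pos two_pos, ENNReal.ofReal_ofNat]
    rw [h4]
    refine le_trans (measure_mono fun ω hω => ?_) hn.le
    exact (not_le.1 (show ¬ ‖_ - K‖ ≤ τ from hω)).le
  linarith

end Asymptotics

end HybridReg

/-! ### The main theorem. -/

open HybridReg in
theorem theorem3
    {H : Type*} [NormedAddCommGroup H] [InnerProductSpace ℝ H] [CompleteSpace H]
    [SecondCountableTopology H] [MeasurableSpace H] [BorelSpace H]
    {Ω : Type*} [MeasurableSpace Ω] (P : Measure Ω) [IsProbabilityMeasure P]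
    -- the functional linear model and the i.i.d. sample
    (a : ℝ) (β : H) (X : ℕ → Ω → H) (e y : ℕ → Ω → ℝ)
    (hmodel : ∀ i ω, y i ω = a + inner ℝ (X i ω) β + e i ω)
    (hindep : iIndepFun (fun i ω => (X i ω, e i ω)) P)
    (hident : ∀ i, IdentDistrib (fun ω => (X i ω, e i ω)) (fun ω => (X 0 ω, e 0 ω)) P P)
    (hXe : IndepFun (X 0) (e 0) P)
    (he_sq : MemLp (e 0) 2 P) (he_mean : ∫ ω, e 0 ω ∂P = 0)
    -- the covariate is a centred Gaussian element
    (hX_gauss : HasGaussianLaw (X 0) P) (hX_mean : ∫ ω, X 0 ω ∂P = 0)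
    -- spectrum of its covariance operator, decay conditions
    (lam : ℕ → ℝ) (φ : HilbertBasis ℕ ℝ H)
    (heigen : ∀ j, covarianceOperator (P.map (X 0)) (φ j) = lam j • φ j)
    (α η : ℝ) (hlam : EigenvalueDecay α lam)
    (hβ : CoefficientDecay η (fun j => inner ℝ β (φ j)))
    (hαη : α < 2 * η)
    -- number of unpenalised components
    (r : ℕ) (hr : ∃ j < r, inner ℝ β (φ j) ≠ 0)
    -- spectrum of the empirical covariance operator, as a measurable function of the covariates
    (lamhat : ∀ n : ℕ, (Fin n → H) → Fin n → ℝ) (φhat : ∀ n : ℕ, (Fin n → H) → Fin n → H)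
    (hspec : ∀ (n : ℕ) (x : Fin n → H), IsSpectrum (empCov x) (lamhat n x) (φhat n x))
    (hmeas : ∀ (n : ℕ) (j : Fin n), Measurable fun x : Fin n → H => φhat n x j)
    -- the regularisation parameter
    (c ε : ℝ) (hc : 0 < c) (hε : 0 < ε) (ρ : ℕ → ℝ)
    (hρ : ρ ~[atTop] fun n : ℕ => c * (n : ℝ) ^ (-ε))
    (hregime : (η - 1 / 2 < α ∧ ε < α / (5 * α - 2 * η + 2)) ∨
      (α < η - 1 / 2 ∧ ε < α / (3 * α + 1))) :
    let βTR : ℕ → Ω → H := fun n ω =>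
      tikhonov (ρ n) (fun i : Fin n => X i ω) (fun i : Fin n => y i ω)
    let βHR : ℕ → Ω → H := fun n ω =>
      hybrid r (ρ n) (φhat n fun i : Fin n => X i ω) (fun i : Fin n => X i ω)
        (fun i : Fin n => y i ω)
    ∃ κ₀ : ℝ, 0 < κ₀ ∧ ∀ᶠ n : ℕ in atTop,
      Integrable (sqLoss (βTR n) β) P ∧ Integrable (sqLoss (βHR n) β) P ∧
      MSE P (βTR n) β - MSE P (βHR n) β > κ₀ * (n : ℝ) ^ (-2 * ε) := by
  intro βTR βHR
  obtain ⟨hα, hlam0, hanti, -⟩ := hlam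
  obtain ⟨k, hkr, hk⟩ := hr
  have hX0 : AEMeasurable (X 0) P := hX_gauss.aemeasurable
  have he0 : AEMeasurable (e 0) P := he_sq.aestronglyMeasurable.aemeasurable
  have hgauss : IsGaussian (P.map (X 0)) := hX_gauss.isGaussian_map
  have hprob : IsProbabilityMeasure (P.map (e 0)) := Measure.isProbabilityMeasure_map he0
  have hμ : ∫ x, x ∂(P.map (X 0)) = 0 := by
    exact (integral_map hX0 aestronglyMeasurable_id).trans hX_mean
  have hν : MemLp id 2 (P.map (e 0)) := (memLp_map_measure_iff aestronglyMeasurable_id he0).2 he_sq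
  have hν0 : ∫ t, t ∂(P.map (e 0)) = 0 := by
    exact (integral_map he0 aestronglyMeasurable_id).trans he_mean
  obtain ⟨C, N, hC0, hC⟩ := exists_lintegral_coefficientError_le hμ hν hν0 φ heigen hlam0
    hanti.antitone a β r hspec hmeas
  have hK : ∀ v k, inner ℝ (φ k) (covarianceOperator (P.map (X 0)) v) =
      lam k * inner ℝ (φ k) v := by
    intro v k
    rw [← inner_covarianceOperator_comm, heigen, real_inner_smul_left]
  obtain ⟨τ, hτ, hbias⟩ := exists_shrinkage_bias_ge φ hK heigen hanti hkr hk
  have hS := eventually_half_le_real_norm_empCov_sub_le hX_gauss.memLp_two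
    (hindep.comp (fun _ => Prod.fst) fun _ => measurable_fst)
    (fun i => (hident i).comp measurable_fst) hτ
  have hb : 0 < (inner ℝ β (φ k) : ℝ) ^ 2 := by positivity
  set M := ‖covarianceOperator (P.map (X 0))‖ + 1 + 2 * c with hM
  have hM0 : 0 < M := by positivity
  -- Chosen so that `w ≥ 8 κ n^(-2ε)`: half of it is `4 κ`, the variance eventually takes at most `2
  -- κ`, and `2 κ > κ` remains.
  set κ := 1 / 64 * (c / 2 / M) ^ 2 * (inner ℝ β (φ k) : ℝ) ^ 2 with hκ
  have hκ0 : 0 < κ := by positivity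
  refine ⟨κ, hκ0, ?_⟩
  filter_upwards [hS, eventually_penalty_bounds hc hε hρ, eventually_ge_atTop N,
    eventually_gt_atTop r, eventually_inv_le_rpow (penalty_exponent_lt_half hα hregime)
      (3 * r * C) (by positivity : 0 < 2 * κ)] with n hSn hρn hNn hrn hrate
  have hnR : (0 : ℝ) < n := by exact_mod_cast (Nat.zero_le r).trans_lt hrn
  have hpow : 0 < (n : ℝ) ^ (-ε) := by positivity
  have hρ0 : 0 < ρ n := lt_of_lt_of_le (by positivity) hρn.1
  set w := 1 / 8 * (ρ n / M) ^ 2 * (inner ℝ β (φ k) : ℝ) ^ 2 with hw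
  have hTRint := integrable_norm_tikhonov_sub_sq (a := a) (β := β) (μ := P.map (X 0)) hν
    (hspec n) (hmeas n) hρ0
  obtain ⟨hHRint, hdiff⟩ := integral_tikhonov_sub_integral_hybrid_ge (a := a) (β := β)
    (μ := P.map (X 0)) hν (hspec n) (hmeas n) hρ0 (r := r) (τ := C * (n : ℝ)⁻¹) (by positivity)
    (hC n hNn) (measurableSet_norm_empCov_sub_le _ n τ) hSn (w := w) (by positivity)
    (fun x hx => hbias (hspec n x) hrn hx hρ0 hρn.2)
  have hΦ : AEMeasurable (fun ω => ((fun i : Fin n => X i ω), fun i : Fin n => e i ω)) P :=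
    (aemeasurable_pi_lambda _ fun i : Fin n => (hident i).aemeasurable_fst.fst).prodMk
      (aemeasurable_pi_lambda _ fun i : Fin n => (hident i).aemeasurable_fst.snd)
  have hlaw := map_sample_eq_prod hindep hident hXe n
  -- The estimates on the product law are estimates on the law of the sample, to be pulled back to
  -- `P`.
  rw [← hlaw] at hTRint hHRint hdiff
  have hresp : ∀ ω, (fun i : Fin n => y i ω) =
      response a β ((fun i : Fin n => X i ω), fun i : Fin n => e i ω) :=
    fun ω => funext fun i => hmodel i ω
  have hTR : sqLoss (βTR n) β = fun ω => (fun p : (Fin n → H) × (Fin n → ℝ) =>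
      ‖tikhonov (ρ n) p.1 (response a β p) - β‖ ^ 2)
        ((fun i : Fin n => X i ω), fun i : Fin n => e i ω) := by
    funext ω
    simp only [sqLoss, βTR, hresp]
  have hHR : sqLoss (βHR n) β = fun ω => (fun p : (Fin n → H) × (Fin n → ℝ) =>
      ‖hybrid r (ρ n) (φhat n p.1) p.1 (response a β p) - β‖ ^ 2)
        ((fun i : Fin n => X i ω), fun i : Fin n => e i ω) := by
    funext ω
    simp only [sqLoss, βHR, hresp]
  refine ⟨?_, ?_, ?_⟩
  · rw [hTR]
    exact (integrable_map_measure hTRint.aestronglyMeasurable hΦ).1 hTRint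
  · rw [hHR]
    exact (integrable_map_measure hHRint.aestronglyMeasurable hΦ).1 hHRint
  · rw [integral_map hΦ hTRint.aestronglyMeasurable,
      integral_map hΦ hHRint.aestronglyMeasurable] at hdiff
    rw [MSE, MSE, hTR, hHR]
    refine lt_of_lt_of_le ?_ hdiff
    have hsq : (n : ℝ) ^ (-2 * ε) = ((n : ℝ) ^ (-ε)) ^ 2 := by
      rw [← Real.rpow_natCast, ← Real.rpow_mul hnR.le]
      congr 1
      push_cast
      ring
    have hwge : 8 * κ * (n : ℝ) ^ (-2 * ε) ≤ w := by
      have h1 : (c / 2 / M * (n : ℝ) ^ (-ε)) ^ 2 ≤ (ρ n / M) ^ 2 := by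
        have : c / 2 / M * (n : ℝ) ^ (-ε) = c / 2 * (n : ℝ) ^ (-ε) / M := by ring
        rw [this]
        gcongr
        exact hρn.1
      rw [hsq]
      calc 8 * κ * ((n : ℝ) ^ (-ε)) ^ 2
          = 1 / 8 * (c / 2 / M * (n : ℝ) ^ (-ε)) ^ 2 * (inner ℝ β (φ k) : ℝ) ^ 2 := by
            rw [hκ]
            ring
        _ ≤ w := by
            rw [hw]
            gcongr
    have hpow2 : 0 < (n : ℝ) ^ (-2 * ε) := by positivity
    nlinarith
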